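/- **Theorem 1.** *Real trees.* A metric space $(T,d)$ is a *real tree* if (i) for all $\sigma,\sigma'\in T$ there is an isometry $f_{\sigma,\sigma'}:[0,d(\sigma,\sigma')]\to T$ with $f_{\sigma,\sigma'}(0)=\sigma$ and $f_{\sigma,\sigma'}(d(\sigma,\sigma'))=\sigma'$, whose image is denoted $[\![\sigma,\sigma']\!]$, and (ii) every continuous injective $q:[0,1]\to T$ satisfies $q([0,1])=[\![q(0),q(1)]\!]$. Let $(T,d)$ be a compact real tree, $\rho\in T$ (the root), $\leq$ a linear order on $T$, and $\mu$ a finite Borel measure on $T$, such that: * (Or1) if $\sigma_1\in[\![\rho,\sigma_2]\!]$, then $\sigma_1\leq\sigma_2$; * (Or2) if $\sigma_1\leq\sigma_2\leq\sigma_3$, then $\gamma\in[\![\rho,\sigma_2]\!]$, where $\gamma$ is the point determined by $[\![\rho,\gamma]\!]=[\![\rho,\sigma_1]\!]\cap([\![\rho,\sigma_2]\!]\cup[\![\rho,\sigma_3]\!])$; * (Mes) if $\sigma_1<\sigma_2$, then $\mu(\{\sigma\in T:\sigma_1<\sigma<\sigma_2\})>0$. *Height functions.* Let $\mathcal H$ be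 the set of all functions $h:[0,M]\to[0,\infty)$, where $M=\zeta(h)\geq 0$ is any real number, that are left-continuous with right limits and satisfy $h(0)=h(0+)=0$ and $h(t+)\leq h(t)$ for $t\in[0,M)$ (if $M=0$, this just says $h(0)=0$). For $h\in\mathcal H$ and $s,t\in[0,M]$ set $d_h(s,t)=h(s)+h(t)-2\inf_{[s\wedge t,\,s\vee t]}h$. Let $T_h$ be the quotient of $[0,M]$ by the relation $d_h(s,t)=0$, with the distance induced by $d_h$ (also denoted $d_h$), let $p_h:[0,M]\to T_h$ be the canonical projection, and set $\rho_h=p_h(0)$. For $\sigma\in T_h$ let $\ell(\sigma)=\inf p_h^{-1}(\{\sigma\})$ and $r(\sigma)=\inf\{t\in(\ell(\sigma),M]:p_h(t)\neq\sigma\}$, with $\inf\emptyset=M$. Write $\sigma\leq_h\sigma'$ iff $\ell(\sigma)\leq\ell(\sigma')$, and let $\mu_h(A)=\lambda(p_h^{-1}(A))$ for Borel $A\subset T_h$, where $\lambda$ is the Lebesgue measure. Say that $h$ satisfies (Min) if the set of latter-visit times $S(h)=[0,M]\setminus\bigcup_{\sigma\in T_h}[\ell(\sigma),r(\sigma)]$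 is Lebesgue-null. *Conclusion.* There is a unique $h\in\mathcal H$ satisfying (Min) such that $(T,d,\rho,\leq,\mu)$ and $(T_h,d_h,\rho_h,\leq_h,\mu_h)$ are equivalent, that is, such that there is an isometry $f$ from $(T,d)$ onto $(T_h,d_h)$ with $f(\rho)=\rho_h$, with $f(\sigma_1)\leq_h f(\sigma_2)$ whenever $\sigma_1\leq\sigma_2$, and with $\mu_h=\mu\circ f^{-1}$. -/

import Mathlib

open Set Filter Topology MeasureTheory

namespace RealTree

section Trees

variable {T : Type*} [MetricSpace T]

/-- `f`, restricted to `[0, d(a, b)]`, is an isometry into `T` with `f 0 = a` and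
`f (d(a, b)) = b` (the values of `f` outside this interval play no role). -/
structure IsGeodesic (f : ℝ → T) (a b : T) : Prop where
  map_zero : f 0 = a
  map_dist : f (dist a b) = b
  isometry : ∀ s ∈ Icc 0 (dist a b), ∀ t ∈ Icc 0 (dist a b), dist (f s) (f t) = |s - t|

/-- The segment `⟦a, b⟧`: the image of `[0, d(a, b)]` under a geodesic from `a` to `b`.
In a real tree this image is the same for all geodesics from `a` to `b`. -/
def seg (a b : T) : Set T :=
  {c | ∃ f : ℝ → T, IsGeodesic f a b ∧ c ∈ f '' Icc 0 (dist a b)}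

/-- Real trees: any two points are joined by a geodesic, and any injective path from
`a` to `b` runs through the segment `⟦a, b⟧`. -/
structure IsRealTree (T : Type*) [MetricSpace T] : Prop where
  exists_geodesic : ∀ a b : T, ∃ f : ℝ → T, IsGeodesic f a b
  range_eq_seg : ∀ q : Icc (0 : ℝ) 1 → T, Continuous q → Function.Injective q →
    range q = seg (q 0) (q 1)

/-- (Or1): the order extends the genealogical order of the tree rooted at `ρ`. -/
def Or1 [LE T] (ρ : T) : Prop :=
  ∀ a b : T, a ∈ seg ρ b → a ≤ b

/-- (Or2): if `a ≤ b ≤ c`, then the branching point `γ` of `a` on the subtree spanned by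
`ρ`, `b` and `c` lies on `⟦ρ, b⟧`. -/
def Or2 [LE T] (ρ : T) : Prop :=
  ∀ a b c : T, a ≤ b → b ≤ c →
    ∀ γ : T, seg ρ γ = seg ρ a ∩ (seg ρ b ∪ seg ρ c) → γ ∈ seg ρ b

/-- (Mes): the measure charges every nonempty open interval of the order. -/
def Mes [LinearOrder T] [MeasurableSpace T] (μ : Measure T) : Prop :=
  ∀ a b : T, a < b → 0 < μ {c | a < c ∧ c < b}

/-- Equivalence of two rooted, ordered and measured metric spaces: there is an isometry from
the first onto the second that preserves roots, orders and measures. -/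
def Equivalent {X Y : Type*}
    [MetricSpace X] [LE X] [MeasurableSpace X] (ρ : X) (μ : Measure X)
    [MetricSpace Y] [LE Y] [MeasurableSpace Y] (ρ' : Y) (μ' : Measure Y) : Prop :=
  ∃ f : X ≃ᵢ Y, f ρ = ρ' ∧ (∀ a b : X, a ≤ b → f a ≤ f b) ∧ μ' = μ.map f

end Trees

/-- Height functions: non-negative càglàd functions on a compact interval `[0, M]`, vanishing
at `0` and `0+`, without positive jumps. All limits are taken inside `[0, M]`. -/
structure HeightFunction where
  /-- the lifetime `ζ(h) = M` -/
  lifetime : ℝ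
  lifetime_nonneg : 0 ≤ lifetime
  toFun : Icc (0 : ℝ) lifetime → ℝ
  nonneg : ∀ t, 0 ≤ toFun t
  left_cont : ∀ t, ContinuousWithinAt toFun (Iic t) t
  /-- right limits exist and `h(t+) ≤ h(t)` on `[0, M)` -/
  right_lim : ∀ t : Icc (0 : ℝ) lifetime, (t : ℝ) < lifetime → ∃ l ≤ toFun t, Tendsto toFun (𝓝[>] t) (𝓝 l)
  map_zero : toFun ⟨0, le_rfl, lifetime_nonneg⟩ = 0
  map_zero_right : Tendsto toFun (𝓝[>] ⟨0, le_rfl, lifetime_nonneg⟩) (𝓝 0)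

namespace HeightFunction

variable (h : HeightFunction)

/-- The infimum `m_h(s, t)` of `h` between `s` and `t`. -/
noncomputable def minBetween (s t : Icc (0 : ℝ) h.lifetime) : ℝ :=
  sInf (h.toFun '' uIcc s t)

/-- `d_h(s, t) = h(s) + h(t) - 2 m_h(s, t)`. -/
noncomputable def treeDist (s t : Icc (0 : ℝ) h.lifetime) : ℝ :=
  h.toFun s + h.toFun t - 2 * h.minBetween s t

theorem bddBelow_image (A : Set (Icc (0 : ℝ) h.lifetime)) : BddBelow (h.toFun '' A) :=
  ⟨0, by rintro _ ⟨t, _, rfl⟩; exact h.nonneg t⟩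

theorem minBetween_le {s t r : Icc (0 : ℝ) h.lifetime} (hr : r ∈ uIcc s t) :
    h.minBetween s t ≤ h.toFun r :=
  csInf_le (h.bddBelow_image _) ⟨r, hr, rfl⟩

theorem le_minBetween {s t : Icc (0 : ℝ) h.lifetime} {x : ℝ}
    (hx : ∀ r ∈ uIcc s t, x ≤ h.toFun r) : x ≤ h.minBetween s t :=
  le_csInf ⟨_, s, left_mem_uIcc, rfl⟩ (by rintro _ ⟨r, hr, rfl⟩; exact hx r hr)

theorem treeDist_self (s : Icc (0 : ℝ) h.lifetime) : h.treeDist s s = 0 := by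
  simp [treeDist, minBetween, two_mul]

theorem treeDist_comm (s t : Icc (0 : ℝ) h.lifetime) : h.treeDist s t = h.treeDist t s := by
  simp only [treeDist, minBetween, uIcc_comm s t]; ring

theorem treeDist_triangle (s u t : Icc (0 : ℝ) h.lifetime) :
    h.treeDist s t ≤ h.treeDist s u + h.treeDist u t := by
  have h1 : min (h.minBetween s u) (h.minBetween u t) ≤ h.minBetween s t := by
    refine h.le_minBetween fun r hr => ?_
    rcases uIcc_subset_uIcc_union_uIcc (b := u) hr with hr | hr
    · exact (min_le_left _ _).trans (h.minBetween_le hr)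
    · exact (min_le_right _ _).trans (h.minBetween_le hr)
  have h2 : h.minBetween s u ≤ h.toFun u := h.minBetween_le right_mem_uIcc
  have h3 : h.minBetween u t ≤ h.toFun u := h.minBetween_le left_mem_uIcc
  unfold treeDist
  rcases min_le_iff.1 h1 with h4 | h4 <;> linarith

/-- The interval `[0, M]` endowed with the pseudo-distance `d_h`. -/
def Times : Type := Icc (0 : ℝ) h.lifetime

noncomputable instance : PseudoMetricSpace h.Times where
  dist s t := h.treeDist s t
  dist_self s := h.treeDist_self s
  dist_comm s t := h.treeDist_comm s t
  dist_triangle s u t := h.treeDist_triangle s u t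

/-- The coded tree `T_h`: the metric quotient of `([0, M], d_h)`, in which `s` and `t` are
identified if and only if `d_h(s, t) = 0`. -/
def Tree : Type := SeparationQuotient h.Times

noncomputable instance : MetricSpace h.Tree :=
  inferInstanceAs (MetricSpace (SeparationQuotient h.Times))

/-- `T_h` carries its Borel sigma-algebra. -/
noncomputable instance : MeasurableSpace h.Tree := borel h.Tree

instance : BorelSpace h.Tree := ⟨rfl⟩

/-- The canonical projection `p_h` from `[0, M]` onto `T_h`. -/
noncomputable def proj (t : Icc (0 : ℝ) h.lifetime) : h.Tree :=
  SeparationQuotient.mk (X := h.Times) t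

theorem dist_proj (s t : Icc (0 : ℝ) h.lifetime) :
    dist (h.proj s) (h.proj t) = h.treeDist s t := rfl

theorem proj_eq_proj_iff (s t : Icc (0 : ℝ) h.lifetime) :
    h.proj s = h.proj t ↔ h.treeDist s t = 0 := by
  rw [← h.dist_proj, dist_eq_zero]

theorem proj_surjective : Function.Surjective h.proj :=
  SeparationQuotient.surjective_mk (X := h.Times)

/-- The root `ρ_h = p_h(0)`. -/
noncomputable def root : h.Tree := h.proj ⟨0, le_rfl, h.lifetime_nonneg⟩

/-- `ℓ(σ) = inf p_h⁻¹({σ})`. -/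
noncomputable def firstVisit (σ : h.Tree) : ℝ :=
  sInf {x : ℝ | ∃ t : Icc (0 : ℝ) h.lifetime, (t : ℝ) = x ∧ h.proj t = σ}

/-- The order of `T_h`: `σ ≤_h σ'` if and only if `inf p_h⁻¹({σ}) ≤ inf p_h⁻¹({σ'})`. -/
noncomputable instance : LE h.Tree := ⟨fun σ σ' => h.firstVisit σ ≤ h.firstVisit σ'⟩

/-- `r(σ) = inf {t > ℓ(σ) : p_h(t) ≠ σ}`, where the infimum is taken in `[0, M]`: the
infimum of the empty set is `M`. -/
noncomputable def firstExit (σ : h.Tree) : ℝ :=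
  sInf (insert h.lifetime
    {x : ℝ | ∃ t : Icc (0 : ℝ) h.lifetime, (t : ℝ) = x ∧ h.firstVisit σ < x ∧ h.proj t ≠ σ})

/-- The set `F(h)` of times of first visit. -/
def firstVisitTimes : Set ℝ :=
  ⋃ σ : h.Tree, Icc (h.firstVisit σ) (h.firstExit σ)

/-- The set `S(h)` of times of latter visit. -/
def latterVisitTimes : Set ℝ :=
  Icc 0 h.lifetime \ h.firstVisitTimes

/-- (Min): the set of times of latter visit is Lebesgue-null. -/
def IsMinimal : Prop := volume h.latterVisitTimes = 0

/-- The measure `μ_h` on `T_h`: the image of the Lebesgue measure of `[0, M]` under `p_h`. -/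
noncomputable def treeMeasure : Measure h.Tree :=
  ((volume : Measure ℝ).comap (fun t : Icc (0 : ℝ) h.lifetime => (t : ℝ))).map h.proj

theorem tendsto_proj_left (t : Icc (0 : ℝ) h.lifetime) :
    Tendsto h.proj (𝓝[≤] t) (𝓝 (h.proj t)) := by
  rw [Metric.tendsto_nhds]
  intro ε hε
  have h1 := Metric.tendsto_nhds.1 (h.left_cont t) (ε / 4) (by positivity)
  rw [eventually_nhdsWithin_iff, Metric.eventually_nhds_iff] at h1
  obtain ⟨δ, hδ, H⟩ := h1
  rw [eventually_nhdsWithin_iff, Metric.eventually_nhds_iff]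
  refine ⟨δ, hδ, fun s hs hst => ?_⟩
  have key : ∀ r ∈ uIcc s t, |h.toFun r - h.toFun t| < ε / 4 := by
    intro r hr
    rw [uIcc_of_le hst] at hr
    refine H ?_ hr.2
    have e1 : (s : ℝ) ≤ r := hr.1
    have e2 : (r : ℝ) ≤ t := hr.2
    have hs' : |(s : ℝ) - t| < δ := hs
    rw [abs_of_nonpos (by linarith)] at hs'
    change |(r : ℝ) - t| < δ
    rw [abs_of_nonpos (by linarith)]
    linarith
  have h2 : h.toFun t - ε / 4 ≤ h.minBetween s t :=
    h.le_minBetween fun r hr => by linarith [(abs_lt.1 (key r hr)).1]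
  have h3 := (abs_lt.1 (key s left_mem_uIcc)).2
  rw [dist_proj, treeDist]
  linarith

/-- The projection is Borel measurable, so that `treeMeasure` is indeed `A ↦ λ(p_h⁻¹(A))`. -/
theorem measurable_proj : Measurable h.proj := by
  -- approximate `t` from the left by points of a grid of mesh `1 / (n + 1)`
  let g : ℕ → Icc (0 : ℝ) h.lifetime → Icc (0 : ℝ) h.lifetime := fun n t =>
    projIcc 0 h.lifetime h.lifetime_nonneg ((⌈(t : ℝ) * (n + 1)⌉ - 1 : ℤ) / (n + 1))
  have hg : ∀ n t, (g n t : ℝ) ≤ t ∧ (t : ℝ) - 1 / (n + 1) ≤ g n t := by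
    intro n t
    have hn : (0 : ℝ) < n + 1 := by positivity
    have ht := t.2
    have a1 : ((⌈(t : ℝ) * (n + 1)⌉ - 1 : ℤ) : ℝ) / (n + 1) ≤ t := by
      rw [div_le_iff₀ hn]; push_cast; linarith [Int.ceil_lt_add_one ((t : ℝ) * (n + 1))]
    have a2 : (t : ℝ) - 1 / (n + 1) ≤ ((⌈(t : ℝ) * (n + 1)⌉ - 1 : ℤ) : ℝ) / (n + 1) := by
      rw [le_div_iff₀ hn, sub_mul, div_mul_cancel₀ _ hn.ne']
      push_cast; linarith [Int.le_ceil ((t : ℝ) * (n + 1))]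
    simp only [g, coe_projIcc]
    rw [min_eq_right (a1.trans ht.2)]
    exact ⟨max_le ht.1 a1, a2.trans (le_max_right _ _)⟩
  refine measurable_of_tendsto_metrizable (f := fun n t => h.proj (g n t)) (fun n => ?_) ?_
  · have : Measurable fun z : ℤ =>
        h.proj (projIcc 0 h.lifetime h.lifetime_nonneg ((z - 1 : ℤ) / ((n : ℝ) + 1))) :=
      measurable_from_top
    exact this.comp (Int.measurable_ceil.comp (measurable_subtype_coe.mul_const _))
  · rw [tendsto_pi_nhds]
    intro t
    refine (h.tendsto_proj_left t).comp (tendsto_nhdsWithin_iff.2 ⟨?_, ?_⟩)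
    · rw [tendsto_subtype_rng]
      refine tendsto_of_tendsto_of_tendsto_of_le_of_le (g := fun n : ℕ => (t : ℝ) - 1 / (n + 1))
        (h := fun _ => (t : ℝ)) ?_ tendsto_const_nhds (fun n => (hg n t).2) (fun n => (hg n t).1)
      simpa using tendsto_const_nhds.sub (tendsto_one_div_add_atTop_nhds_zero_nat (𝕜 := ℝ))
    · exact Eventually.of_forall fun n => (hg n t).1

theorem treeMeasure_apply {A : Set h.Tree} (hA : MeasurableSet A) :
    h.treeMeasure A = volume ((fun t : Icc (0 : ℝ) h.lifetime => (t : ℝ)) '' (h.proj ⁻¹' A)) := by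
  rw [treeMeasure, Measure.map_apply h.measurable_proj hA,
    comap_subtype_coe_apply measurableSet_Icc]

end HeightFunction

end RealTree

/-! In a real tree rooted at `ρ`, the Gromov product `(a|b)` is the height of the last common
ancestor of `a` and `b`, and membership in a segment `⟦ρ, b⟧` becomes an equality of Gromov
products. In these terms (Or2) yields `(a|c) ≤ (a|b)` for `a ≤ b ≤ c`. Together with
0-hyperbolicity, existence of ancestors and (Or1), this is all the tree structure that is used later
(`IsOrderedTree`).

Existence: explore `T` in increasing order at unit speed for `μ`, so that `a` is visited during
`[μ(Iio a), μ(Iic a)]`; by (Mes) these intervals are disjoint and ordered like the points. In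
general the visited point is the limit of the points discovered strictly before, which exists by
compactness and the contour property (`IsContour.exists_tendsto`). Let `h(t)` be its height. The
infimum of `h` between `s` and `t` is the Gromov product of the two visited points
(`minBetween_heightOf`), so `T_h` is isometric to `T`. Spreading each atom of `μ` uniformly over its
visit interval turns `μ` into Lebesgue measure (`map_visitTime`); this gives both `μ_h = μ ∘ f⁻¹`
and (Min).

Uniqueness: for a minimal `h` and an equivalence `e`, the intervals `[ℓ(e a), r(e a)]` are disjoint,
ordered like `T`, and cover almost all of `[0, M]`. Comparing measures gives `ℓ(e a) = μ(Iio a)` and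
`r(e a) = μ(Iic a)`. Thus `h` is determined almost everywhere, hence everywhere by left continuity
and `h(0) = 0` (`HeightFunction.ext_of_null`). -/

namespace RealTree

/-! ### Geodesics and Gromov products in real trees. -/

section RealTreeGeometry

variable {T : Type*} [MetricSpace T]

theorem IsGeodesic.dist_left {f : ℝ → T} {a b : T} (hf : IsGeodesic f a b) {s : ℝ}
    (hs : s ∈ Icc 0 (dist a b)) : dist a (f s) = s := by
  have := hf.isometry 0 ⟨le_rfl, dist_nonneg⟩ s hs
  rwa [hf.map_zero, zero_sub, abs_neg, abs_of_nonneg hs.1] at this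

theorem IsGeodesic.dist_right {f : ℝ → T} {a b : T} (hf : IsGeodesic f a b) {s : ℝ}
    (hs : s ∈ Icc 0 (dist a b)) : dist (f s) b = dist a b - s := by
  have := hf.isometry s hs (dist a b) ⟨dist_nonneg, le_rfl⟩
  rwa [hf.map_dist, abs_sub_comm, abs_of_nonneg (by linarith [hs.2])] at this

theorem IsGeodesic.restrict {f : ℝ → T} {a b : T} (hf : IsGeodesic f a b) {s : ℝ}
    (hs : s ∈ Icc 0 (dist a b)) : IsGeodesic f a (f s) where
  map_zero := hf.map_zero
  map_dist := by rw [hf.dist_left hs]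
  isometry u hu v hv := by
    rw [hf.dist_left hs] at hu hv
    exact hf.isometry u ⟨hu.1, hu.2.trans hs.2⟩ v ⟨hv.1, hv.2.trans hs.2⟩

theorem dist_add_dist_of_mem_seg {a b c : T} (hc : c ∈ seg a b) :
    dist a c + dist c b = dist a b := by
  obtain ⟨f, hf, s, hs, rfl⟩ := hc
  rw [hf.dist_left hs, hf.dist_right hs]; ring

/-- The concatenation of two paths of unit speed is `1`-Lipschitz. -/
theorem dist_concat_le {f k : ℝ → T} {A B : ℝ}
    (hf : ∀ s ∈ Icc 0 A, ∀ t ∈ Icc 0 A, dist (f s) (f t) = |s - t|)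
    (hk : ∀ s ∈ Icc 0 B, ∀ t ∈ Icc 0 B, dist (k s) (k t) = |s - t|)
    (hA : 0 ≤ A) (hB : 0 ≤ B) (hfk : f A = k 0) {s t : ℝ} (hs : s ∈ Icc 0 (A + B))
    (ht : t ∈ Icc 0 (A + B)) :
    dist (if s ≤ A then f s else k (s - A)) (if t ≤ A then f t else k (t - A)) ≤ |s - t| := by
  wlog hst : s ≤ t generalizing s t
  · rw [dist_comm, abs_sub_comm]; exact this ht hs (le_of_not_ge hst)
  split_ifs with h1 h2 h2
  · exact (hf s ⟨hs.1, h1⟩ t ⟨ht.1, h2⟩).le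
  · have e1 := hf s ⟨hs.1, h1⟩ A ⟨hA, le_rfl⟩
    have e2 := hk 0 ⟨le_rfl, hB⟩ (t - A) ⟨by linarith, by linarith [ht.2]⟩
    have e3 := dist_triangle (f s) (f A) (k (t - A))
    rw [e1, hfk, e2, abs_of_nonpos (by linarith), abs_of_nonpos (by linarith)] at e3
    rw [abs_of_nonpos (by linarith)]; linarith
  · linarith
  · rw [hk _ ⟨by linarith, by linarith [hs.2]⟩ _ ⟨by linarith, by linarith [ht.2]⟩]
    exact le_of_eq (by congr 1; ring)

/-- Concatenating geodesics through `c` gives a 1-Lipschitz path whose length is the distance of its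
endpoints; no subpath can then be shortened, so it is a geodesic. -/
theorem IsRealTree.mem_seg (hT : IsRealTree T) {a b c : T}
    (h : dist a c + dist c b = dist a b) : c ∈ seg a b := by
  obtain ⟨f, hf⟩ := hT.exists_geodesic a c
  obtain ⟨k, hk⟩ := hT.exists_geodesic c b
  have hA : 0 ≤ dist a c := dist_nonneg
  have hB : 0 ≤ dist c b := dist_nonneg
  have hfk : f (dist a c) = k 0 := by rw [hf.map_dist, hk.map_zero]
  let F : ℝ → T := fun s => if s ≤ dist a c then f s else k (s - dist a c)
  have hF : ∀ s ∈ Icc 0 (dist a b), ∀ t ∈ Icc 0 (dist a b), dist (F s) (F t) ≤ |s - t| := by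
    intro s hs t ht
    rw [← h] at hs ht
    exact dist_concat_le hf.isometry hk.isometry hA hB hfk hs ht
  have F0 : F 0 = a := by simp [F, hA, hf.map_zero]
  have F1 : F (dist a b) = b := by
    simp only [F]
    split_ifs with h1
    · have : dist c b = 0 := by linarith
      have hcb := dist_eq_zero.1 this
      subst hcb
      exact hf.map_dist
    · rw [← h, add_sub_cancel_left, hk.map_dist]
  refine ⟨F, ⟨F0, F1, ?_⟩, dist a c, ⟨hA, by linarith⟩, by simp [F, hf.map_dist]⟩
  intro s hs t ht
  wlog hst : s ≤ t generalizing s t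
  · rw [dist_comm, abs_sub_comm]; exact this t ht s hs (le_of_not_ge hst)
  refine le_antisymm (hF s hs t ht) ?_
  have e1 := hF 0 ⟨le_rfl, dist_nonneg⟩ s hs
  have e2 := hF t ht (dist a b) ⟨dist_nonneg, le_rfl⟩
  have e3 := dist_triangle4 (F 0) (F s) (F t) (F (dist a b))
  rw [F0, F1] at e3
  rw [F0, abs_of_nonpos (by linarith [hs.1])] at e1
  rw [F1, abs_of_nonpos (by linarith [ht.2])] at e2
  rw [abs_of_nonpos (by linarith)]
  linarith

theorem IsRealTree.image_eq_seg (hT : IsRealTree T) {q : ℝ → T} {L : ℝ} (hL : 0 < L)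
    (hq : ContinuousOn q (Icc 0 L)) (hi : InjOn q (Icc 0 L)) :
    q '' Icc 0 L = seg (q 0) (q L) := by
  have hm : ∀ x : Icc (0 : ℝ) 1, L * x ∈ Icc 0 L := fun x =>
    ⟨mul_nonneg hL.le x.2.1, by nlinarith [x.2.2]⟩
  have h1 := hT.range_eq_seg (fun x => q (L * x))
    (hq.comp_continuous (by fun_prop) hm) (by
      intro x y hxy
      have := hi (hm x) (hm y) hxy
      exact Subtype.ext (mul_left_cancel₀ hL.ne' this))
  have e0 : q (L * ((0 : Icc (0 : ℝ) 1) : ℝ)) = q 0 := by simp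
  have e1 : q (L * ((1 : Icc (0 : ℝ) 1) : ℝ)) = q L := by simp
  rw [e0, e1] at h1
  rw [← h1]
  ext y
  constructor
  · rintro ⟨s, hs, rfl⟩
    refine ⟨⟨s / L, div_nonneg hs.1 hL.le, (div_le_one hL).2 hs.2⟩, ?_⟩
    simp [mul_div_cancel₀ _ hL.ne']
  · rintro ⟨x, rfl⟩
    exact ⟨_, hm x, rfl⟩

/-- An injective path fills the whole segment, so `k s` lies on the image of `f`; its distance to
`a` fixes the parameter. -/
theorem IsRealTree.geodesic_unique (hT : IsRealTree T) {f k : ℝ → T} {a b : T}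
    (hf : IsGeodesic f a b) (hk : IsGeodesic k a b) {s : ℝ} (hs : s ∈ Icc 0 (dist a b)) :
    f s = k s := by
  rcases eq_or_lt_of_le (dist_nonneg (x := a) (y := b)) with h0 | h0
  · have : s = 0 := le_antisymm (by rw [h0]; exact hs.2) hs.1
    rw [this, hf.map_zero, hk.map_zero]
  · have hfi : InjOn f (Icc 0 (dist a b)) := by
      intro u hu v hv huv
      have := hf.isometry u hu v hv
      rw [huv, dist_self, eq_comm, abs_eq_zero] at this
      linarith
    have hfc : ContinuousOn f (Icc 0 (dist a b)) :=
      (LipschitzOnWith.of_dist_le_mul (K := 1) fun u hu v hv => by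
        rw [hf.isometry u hu v hv, Real.dist_eq]; simp).continuousOn
    have h1 := hT.image_eq_seg h0 hfc hfi
    rw [hf.map_zero, hf.map_dist] at h1
    have h2 : k s ∈ f '' Icc 0 (dist a b) := by rw [h1]; exact ⟨k, hk, s, hs, rfl⟩
    obtain ⟨u, hu, huk⟩ := h2
    have e1 := hf.dist_left hu
    have e2 := hk.dist_left hs
    rw [huk, e2] at e1
    rw [← huk, e1]

/-- The Gromov product of `a` and `b` based at `ρ`; in a real tree, this is the height of their
most recent common ancestor. -/
noncomputable def gromov (ρ a b : T) : ℝ := (dist ρ a + dist ρ b - dist a b) / 2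

theorem gromov_comm (ρ a b : T) : gromov ρ a b = gromov ρ b a := by
  simp only [gromov, dist_comm a b]; ring

theorem gromov_self (ρ a : T) : gromov ρ a a = dist ρ a := by
  simp [gromov]

theorem gromov_nonneg (ρ a b : T) : 0 ≤ gromov ρ a b := by
  have := dist_triangle a ρ b
  rw [dist_comm a ρ] at this
  simp only [gromov]; linarith

theorem gromov_le_left (ρ a b : T) : gromov ρ a b ≤ dist ρ a := by
  have := dist_triangle ρ a b
  simp only [gromov]; linarith

theorem gromov_le_right (ρ a b : T) : gromov ρ a b ≤ dist ρ b := by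
  rw [gromov_comm]; exact gromov_le_left ρ b a

theorem dist_eq_gromov (ρ a b : T) : dist a b = dist ρ a + dist ρ b - 2 * gromov ρ a b := by
  simp only [gromov]; ring

@[fun_prop]
theorem _root_.Continuous.gromov {X : Type*} [TopologicalSpace X] {u v : X → T} (ρ : T)
    (hu : Continuous u) (hv : Continuous v) : Continuous fun x => gromov ρ (u x) (v x) := by
  unfold RealTree.gromov; fun_prop

theorem gromov_le_add (ρ a b a' b' : T) :
    gromov ρ a b ≤ gromov ρ a' b' + (dist a a' + dist b b') := by
  have h1 := dist_triangle ρ a' a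
  have h2 := dist_triangle ρ b' b
  have h3 := dist_triangle4 a' a b b'
  rw [dist_comm a' a] at h1 h3
  rw [dist_comm b' b] at h2
  simp only [gromov]; linarith

/-- Two geodesics started at `ρ` agree at a height if and only if this height is at most
the Gromov product of their endpoints. -/
theorem IsRealTree.eq_iff_le_gromov (hT : IsRealTree T) {ρ a b : T} {f k : ℝ → T}
    (hf : IsGeodesic f ρ a) (hk : IsGeodesic k ρ b) {s : ℝ} (hs : 0 ≤ s) (hsa : s ≤ dist ρ a)
    (hsb : s ≤ dist ρ b) : f s = k s ↔ s ≤ gromov ρ a b := by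
  constructor
  · intro h
    have e1 := hf.dist_right ⟨hs, hsa⟩
    have e2 := hk.dist_right ⟨hs, hsb⟩
    have e3 := dist_triangle_left a b (f s)
    rw [e1] at e3
    rw [h, e2] at e3
    simp only [gromov]; linarith
  · set m := min (dist ρ a) (dist ρ b) with hm
    have hm0 : 0 ≤ m := le_min dist_nonneg dist_nonneg
    -- Let `c` be the greatest height at which the geodesics meet. Going down from `a` to `f c` and
    -- up to `b` traces the segment `⟦a, b⟧`, so `f c` lies on it and `c` is the Gromov product;
    -- below `c`, geodesics are unique.
    let A : Set ℝ := {u ∈ Icc 0 m | dist (f u) (k u) = 0}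
    have hlip : ∀ (f : ℝ → T) (a : T), IsGeodesic f ρ a → m ≤ dist ρ a →
        ContinuousOn f (Icc 0 m) := fun f a hf hma =>
      (LipschitzOnWith.of_dist_le_mul (K := 1) fun u hu v hv => by
        rw [hf.isometry u ⟨hu.1, hu.2.trans hma⟩ v ⟨hv.1, hv.2.trans hma⟩,
          Real.dist_eq]; simp).continuousOn
    have hAc : IsClosed A :=
      (continuous_dist.comp_continuousOn ((hlip f a hf (min_le_left _ _)).prodMk
        (hlip k b hk (min_le_right _ _)))).preimage_isClosed_of_isClosed
        isClosed_Icc (isClosed_singleton (x := (0 : ℝ)))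
    have hA0 : (0 : ℝ) ∈ A := ⟨⟨le_rfl, hm0⟩, by rw [hf.map_zero, hk.map_zero, dist_self]⟩
    have hAb : BddAbove A := ⟨m, fun u hu => hu.1.2⟩
    set c := sSup A with hc
    have hcA : c ∈ A := hAc.csSup_mem ⟨0, hA0⟩ hAb
    have hca : c ≤ dist ρ a := hcA.1.2.trans (min_le_left _ _)
    have hcb : c ≤ dist ρ b := hcA.1.2.trans (min_le_right _ _)
    have hc0 : 0 ≤ c := hcA.1.1
    have hcfk : f c = k c := dist_eq_zero.1 hcA.2
    -- the concatenation of the two branches above height `c` is injective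
    have key : gromov ρ a b ≤ c := by
      let f' : ℝ → T := fun u => f (dist ρ a - u)
      let k' : ℝ → T := fun u => k (c + u)
      set L₁ := dist ρ a - c with hL₁
      set L₂ := dist ρ b - c with hL₂
      have h1 : 0 ≤ L₁ := by linarith
      have h2 : 0 ≤ L₂ := by linarith
      have hf' : ∀ s ∈ Icc 0 L₁, ∀ t ∈ Icc 0 L₁, dist (f' s) (f' t) = |s - t| := by
        intro s hs t ht
        simp only [f']
        rw [hf.isometry _ ⟨by linarith [hs.2], by linarith [hs.1]⟩ _
          ⟨by linarith [ht.2], by linarith [ht.1]⟩, abs_sub_comm s t]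
        congr 1; ring
      have hk' : ∀ s ∈ Icc 0 L₂, ∀ t ∈ Icc 0 L₂, dist (k' s) (k' t) = |s - t| := by
        intro s hs t ht
        simp only [k']
        rw [hk.isometry _ ⟨by linarith [hs.1], by linarith [hs.2]⟩ _
          ⟨by linarith [ht.1], by linarith [ht.2]⟩]
        congr 1; ring
      have hfk' : f' L₁ = k' 0 := by simp [f', k', hL₁, hcfk]
      let q : ℝ → T := fun u => if u ≤ L₁ then f' u else k' (u - L₁)
      rcases eq_or_lt_of_le (add_nonneg h1 h2) with h0 | h0
      · have := gromov_le_left ρ a b; linarith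
      have hqc : ContinuousOn q (Icc 0 (L₁ + L₂)) :=
        (LipschitzOnWith.of_dist_le_mul (K := 1) fun u hu v hv => by
          rw [Real.dist_eq, NNReal.coe_one, one_mul]
          exact dist_concat_le hf' hk' h1 h2 hfk' hu hv).continuousOn
      have hqi : InjOn q (Icc 0 (L₁ + L₂)) := by
        intro u hu v hv huv
        wlog huv' : u ≤ v generalizing u v
        · exact (this hv hu huv.symm (le_of_not_ge huv')).symm
        simp only [q] at huv
        split_ifs at huv with c1 c2 c2
        · have := hf' u ⟨hu.1, c1⟩ v ⟨hv.1, c2⟩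
          rw [huv, dist_self, eq_comm, abs_eq_zero] at this
          linarith
        -- A common point of the two branches has the same distance to `ρ` along each, so it would
        -- be a meeting height above `c`.
        · exfalso
          push Not at c2
          have i1 : dist ρ a - u ∈ Icc 0 (dist ρ a) := ⟨by linarith, by linarith [hu.1]⟩
          have i2 : c + (v - L₁) ∈ Icc 0 (dist ρ b) := ⟨by linarith, by linarith [hv.2]⟩
          have e1 := hf.dist_left i1
          have e2 := hk.dist_left i2
          simp only [f', k'] at huv
          rw [huv, e2] at e1
          rw [← e1] at huv
          have : c + (v - L₁) ∈ A :=
            ⟨⟨i2.1, le_min (by rw [e1]; exact i1.2) i2.2⟩, by rw [huv, dist_self]⟩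
          have := le_csSup hAb this
          linarith
        · linarith
        · have := hk' (u - L₁) ⟨by linarith, by linarith [hu.2]⟩ (v - L₁)
            ⟨by linarith, by linarith [hv.2]⟩
          rw [huv, dist_self, eq_comm, abs_eq_zero] at this
          linarith
      have hq := hT.image_eq_seg h0 hqc hqi
      have q0 : q 0 = a := by simp [q, h1, f', hf.map_dist]
      have q1 : q (L₁ + L₂) = b := by
        simp only [q]
        split_ifs with c1
        · have h3 : L₂ = 0 := by linarith
          rw [h3, add_zero, hfk']
          simp only [k', add_zero]
          rw [show c = dist ρ b by linarith, hk.map_dist]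
        · simp [k', hL₂, hk.map_dist]
      have q2 : q L₁ = f c := by simp [q, f', hL₁]
      rw [q0, q1] at hq
      have hmem : f c ∈ seg a b := by
        rw [← hq, ← q2]; exact ⟨L₁, ⟨h1, by linarith⟩, rfl⟩
      have e1 := dist_add_dist_of_mem_seg hmem
      have e2 := hf.dist_right ⟨hc0, hca⟩
      have e3 := hk.dist_right ⟨hc0, hcb⟩
      rw [dist_comm a, e2, hcfk, e3] at e1
      simp only [gromov]; linarith
    intro hsg
    have hsc : s ≤ c := hsg.trans key
    have r1 := hf.restrict ⟨hc0, hca⟩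
    have r2 := hk.restrict ⟨hc0, hcb⟩
    rw [← hcfk] at r2
    exact hT.geodesic_unique r1 r2 ⟨hs, by rw [hf.dist_left ⟨hc0, hca⟩]; exact hsc⟩

/-- Real trees are `0`-hyperbolic. -/
theorem IsRealTree.min_gromov_le (hT : IsRealTree T) (ρ a b c : T) :
    min (gromov ρ a b) (gromov ρ b c) ≤ gromov ρ a c := by
  obtain ⟨f, hf⟩ := hT.exists_geodesic ρ a
  obtain ⟨k, hk⟩ := hT.exists_geodesic ρ b
  obtain ⟨l, hl⟩ := hT.exists_geodesic ρ c
  set s := min (gromov ρ a b) (gromov ρ b c)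
  have hs : 0 ≤ s := le_min (gromov_nonneg _ _ _) (gromov_nonneg _ _ _)
  have h1 : s ≤ gromov ρ a b := min_le_left _ _
  have h2 : s ≤ gromov ρ b c := min_le_right _ _
  have ha := h1.trans (gromov_le_left _ _ _)
  have hb := h1.trans (gromov_le_right _ _ _)
  have hc := h2.trans (gromov_le_right _ _ _)
  rw [← hT.eq_iff_le_gromov hf hl hs ha hc, (hT.eq_iff_le_gromov hf hk hs ha hb).2 h1,
    (hT.eq_iff_le_gromov hk hl hs hb hc).2 h2]

theorem IsRealTree.mem_seg_iff (hT : IsRealTree T) (ρ a b : T) :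
    a ∈ seg ρ b ↔ gromov ρ a b = dist ρ a := by
  constructor
  · intro h
    have := dist_add_dist_of_mem_seg h
    simp only [gromov]; linarith
  · intro h
    refine hT.mem_seg ?_
    simp only [gromov] at h; linarith

theorem IsRealTree.exists_ancestor (hT : IsRealTree T) (ρ a : T) {r : ℝ} (h0 : 0 ≤ r)
    (h1 : r ≤ dist ρ a) : ∃ c, dist ρ c = r ∧ gromov ρ c a = dist ρ c := by
  obtain ⟨f, hf⟩ := hT.exists_geodesic ρ a
  refine ⟨f r, hf.dist_left ⟨h0, h1⟩, ?_⟩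
  rw [← hT.mem_seg_iff]
  exact ⟨f, hf, r, ⟨h0, h1⟩, rfl⟩

/-- Condition (Or2) in terms of Gromov products. -/
theorem IsRealTree.gromov_le_of_or2 (hT : IsRealTree T) {ρ : T} [LE T] (h : Or2 ρ) {a b c : T}
    (hab : a ≤ b) (hbc : b ≤ c) : gromov ρ a c ≤ gromov ρ a b := by
  by_contra! hlt
  -- Since `(a|b) < (a|c)`, the branching point in (Or2) is the ancestor of `a` at height `(a|c)`;
  -- it is too high to be an ancestor of `b`.
  obtain ⟨γ, hγ, hγa⟩ := hT.exists_ancestor ρ a (gromov_nonneg ρ a c) (gromov_le_left ρ a c)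
  have four := hT.min_gromov_le ρ
  have hγc : dist ρ γ ≤ gromov ρ γ c := by
    have := four γ a c
    rwa [hγa, hγ, min_self, ← hγ] at this
  have hseg : seg ρ γ = seg ρ a ∩ (seg ρ b ∪ seg ρ c) := by
    ext x
    simp only [mem_inter_iff, mem_union, hT.mem_seg_iff]
    constructor
    · intro hx
      have hle : dist ρ x ≤ dist ρ γ := by rw [← hx]; exact gromov_le_right _ _ _
      refine ⟨le_antisymm (gromov_le_left _ _ _) ?_, .inr (le_antisymm (gromov_le_left _ _ _) ?_)⟩
      · have := four x γ a
        rwa [hx, hγa, min_eq_left hle] at this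
      · have := four x γ c
        rwa [hx, min_eq_left (hle.trans hγc)] at this
    · rintro ⟨hxa, hx⟩
      have hle : dist ρ x ≤ gromov ρ a c := by
        rcases hx with hx | hx
        · have := four a x b
          rw [gromov_comm, hxa, hx, min_self] at this
          linarith
        · have := four a x c
          rwa [gromov_comm, hxa, hx, min_self] at this
      refine le_antisymm (gromov_le_left _ _ _) ?_
      have := four x a γ
      rwa [hxa, gromov_comm ρ a, hγa, hγ, min_eq_left hle] at this
  have h1 := h a b c hab hbc γ hseg
  rw [hT.mem_seg_iff] at h1
  have := four a γ b
  rw [gromov_comm, hγa, h1, min_self, hγ] at this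
  linarith

end RealTreeGeometry

/-- A rooted tree, described by its Gromov products, with an order satisfying (Or1) and (Or2). -/
structure IsOrderedTree {T : Type*} [MetricSpace T] [LinearOrder T] (ρ : T) : Prop where
  min_le : ∀ a b c : T, min (gromov ρ a b) (gromov ρ b c) ≤ gromov ρ a c
  exists_ancestor : ∀ (a : T) (r : ℝ), 0 ≤ r → r ≤ dist ρ a →
    ∃ c, dist ρ c = r ∧ gromov ρ c a = dist ρ c
  le_of_gromov_eq : ∀ a b : T, gromov ρ a b = dist ρ a → a ≤ b
  gromov_le_left : ∀ a b c : T, a ≤ b → b ≤ c → gromov ρ a c ≤ gromov ρ a b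

/-! ### First visit times of the exploration. -/

section VisitTimes

variable {T : Type*} [LinearOrder T] [MeasurableSpace T]

/-- The first visit time of `a` in the exploration at unit speed with respect to `μ`. -/
noncomputable def enter (μ : Measure T) (a : T) : ℝ := μ.real (Iio a)

/-- The time at which the exploration leaves `a` after the first visit. -/
noncomputable def leave (μ : Measure T) (a : T) : ℝ := μ.real (Iic a)

/-- The set of points discovered before time `t`. -/
def discovered (ρ : T) (μ : Measure T) (t : ℝ) : Set T := {x | x = ρ ∨ enter μ x < t}

variable {ρ : T} {μ : Measure T}

theorem enter_nonneg (a : T) : 0 ≤ enter μ a := measureReal_nonneg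

theorem bddBelow_enter (S : Set T) : BddBelow (enter μ '' S) :=
  ⟨0, by rintro _ ⟨x, -, rfl⟩; exact enter_nonneg x⟩

theorem discovered_mono {s t : ℝ} (h : s ≤ t) : discovered ρ μ s ⊆ discovered ρ μ t :=
  fun _ hx => hx.imp id fun hx => hx.trans_le h

variable [IsFiniteMeasure μ]

theorem enter_mono : Monotone (enter μ) := fun _ _ h => measureReal_mono (Iio_subset_Iio h)

theorem leave_mono : Monotone (leave μ) := fun _ _ h => measureReal_mono (Iic_subset_Iic.2 h)

theorem lt_of_enter_lt {a b : T} (h : enter μ a < enter μ b) : a < b :=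
  lt_of_not_ge fun hba => h.not_ge (enter_mono hba)

theorem enter_le_leave (a : T) : enter μ a ≤ leave μ a := measureReal_mono Iio_subset_Iic_self

theorem leave_le (a : T) : leave μ a ≤ μ.real univ := measureReal_mono (subset_univ _)

theorem bddAbove_enter (S : Set T) : BddAbove (enter μ '' S) :=
  ⟨μ.real univ, by rintro _ ⟨x, -, rfl⟩; exact (enter_le_leave x).trans (leave_le x)⟩

end VisitTimes

/-! ### Contours and ordered trees. -/

section OrderedTree

variable {T : Type*} [MetricSpace T] {ρ : T}

/-- A function into a rooted tree compatible with the genealogy: the common ancestor of two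
values is an ancestor of all values in between. -/
def IsContour {ι : Type*} [Preorder ι] (ρ : T) (u : ι → T) : Prop :=
  ∀ s r t : ι, s ≤ r → r ≤ t →
    gromov ρ (u s) (u t) ≤ gromov ρ (u s) (u r) ∧ gromov ρ (u s) (u t) ≤ gromov ρ (u r) (u t)

/-- If `σ` and `σ'` are cluster points, pick a value near `σ'` between two values near `σ`: the
contour property makes `σ` an ancestor of `σ'`. By symmetry they coincide, and compactness
concludes. -/
theorem IsContour.exists_tendsto [CompactSpace T] {ι : Type*} [Preorder ι] {u : ι → T}
    (hu : IsContour ρ u) {l : Filter ι} [l.NeBot]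
    (hl : ∀ A B : Set ι, (∃ᶠ i in l, i ∈ A) → (∃ᶠ i in l, i ∈ B) →
      ∃ x ∈ A, ∃ y ∈ B, ∃ z ∈ A, x ≤ y ∧ y ≤ z) :
    ∃ τ, Tendsto u l (𝓝 τ) := by
  obtain ⟨τ, hτ⟩ := exists_clusterPt_of_compactSpace (map u l)
  have key : ∀ σ σ', ClusterPt σ (map u l) → ClusterPt σ' (map u l) →
      dist ρ σ ≤ gromov ρ σ' σ := by
    intro σ σ' h1 h2
    refine le_of_forall_pos_le_add fun ε hε => ?_
    have f1 : ∃ᶠ i in l, i ∈ {i | dist (u i) σ < ε / 4} :=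
      (mapClusterPt_iff_frequently.1 h1) _ (Metric.ball_mem_nhds σ (by positivity))
    have f2 : ∃ᶠ i in l, i ∈ {i | dist (u i) σ' < ε / 4} :=
      (mapClusterPt_iff_frequently.1 h2) _ (Metric.ball_mem_nhds σ' (by positivity))
    obtain ⟨x, hx, y, hy, z, hz, hxy, hyz⟩ := hl _ _ f1 f2
    simp only [mem_ofPred_eq] at hx hy hz
    have e1 := gromov_le_add ρ σ σ (u x) (u z)
    have e2 := (hu x y z hxy hyz).2
    have e3 := gromov_le_add ρ (u y) (u z) σ' σ
    rw [gromov_self, dist_comm σ, dist_comm σ] at e1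
    linarith
  refine ⟨τ, le_nhds_of_unique_clusterPt fun σ hσ => ?_⟩
  have e1 := key _ _ hσ hτ
  have e2 := key _ _ hτ hσ
  rw [gromov_comm] at e2
  have e3 := dist_eq_gromov ρ τ σ
  rw [← dist_le_zero, dist_comm]
  linarith

theorem exists_between_of_atTop {ι : Type*} [Preorder ι] [IsDirectedOrder ι] [Nonempty ι]
    (A B : Set ι) (hA : ∃ᶠ i in atTop, i ∈ A) (hB : ∃ᶠ i in atTop, i ∈ B) :
    ∃ x ∈ A, ∃ y ∈ B, ∃ z ∈ A, x ≤ y ∧ y ≤ z := by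
  obtain ⟨x, hx⟩ := hA.exists
  obtain ⟨y, hy, hxy⟩ := (hB.and_eventually (eventually_ge_atTop x)).exists
  obtain ⟨z, hz, hyz⟩ := (hA.and_eventually (eventually_ge_atTop y)).exists
  exact ⟨x, hx, y, hy, z, hz, hxy, hyz⟩

theorem exists_between_of_nhdsGT (t : ℝ) (A B : Set ℝ) (hA : ∃ᶠ i in 𝓝[>] t, i ∈ A)
    (hB : ∃ᶠ i in 𝓝[>] t, i ∈ B) : ∃ x ∈ A, ∃ y ∈ B, ∃ z ∈ A, x ≤ y ∧ y ≤ z := by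
  obtain ⟨z, hz, htz⟩ := (hA.and_eventually self_mem_nhdsWithin).exists
  obtain ⟨y, hy, hty⟩ := (hB.and_eventually (Ioo_mem_nhdsGT htz)).exists
  obtain ⟨x, hx, htx⟩ := (hA.and_eventually (Ioo_mem_nhdsGT hty.1)).exists
  exact ⟨x, hx, y, hy, z, hz, htx.2.le, hty.2.le⟩

variable [LinearOrder T]

theorem IsRealTree.isOrderedTree (hT : IsRealTree T) (h1 : Or1 ρ) (h2 : Or2 ρ) :
    IsOrderedTree ρ where
  min_le := hT.min_gromov_le ρ
  exists_ancestor a _ := hT.exists_ancestor ρ a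
  le_of_gromov_eq a b h := h1 a b ((hT.mem_seg_iff ρ a b).2 h)
  gromov_le_left _ _ _ := hT.gromov_le_of_or2 h2

namespace IsOrderedTree

variable (hO : IsOrderedTree ρ)
include hO

theorem root_le (a : T) : ρ ≤ a := by
  refine hO.le_of_gromov_eq _ _ ?_
  simp [gromov]

theorem isContour_id : IsContour ρ (id : T → T) := by
  intro a b c hab hbc
  have h1 := hO.gromov_le_left a b c hab hbc
  refine ⟨h1, ?_⟩
  have h2 := hO.min_le b a c
  rwa [gromov_comm ρ b a, min_eq_right h1] at h2

theorem le_of_le_gromov {a b : T} (h : dist ρ a ≤ gromov ρ a b) : a ≤ b :=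
  hO.le_of_gromov_eq _ _ (le_antisymm (RealTree.gromov_le_left _ _ _) h)

/-- A point `x > a` is not an ancestor of `a`, so `(a|x) < d(ρ, x)`. Any `y ≤ a` has `(y|x) ≤
(a|x)`, which keeps it away from `x`. -/
theorem isClosed_Iic (a : T) : IsClosed (Iic a) := by
  rw [← isOpen_compl_iff, compl_Iic, Metric.isOpen_iff]
  intro x hx
  have hlt : gromov ρ a x < dist ρ x := by
    by_contra! hle
    rw [gromov_comm] at hle
    exact absurd (hO.le_of_le_gromov hle) (not_le.2 hx)
  refine ⟨dist ρ x - gromov ρ a x, by linarith, fun y hy => ?_⟩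
  by_contra hya
  have h1 := (hO.isContour_id y a x (not_lt.1 hya) (le_of_lt hx)).2
  have h2 := gromov_le_add ρ x x y x
  rw [gromov_self, dist_self, dist_comm x y] at h2
  rw [Metric.mem_ball] at hy
  simp only [id] at h1
  linarith

variable [MeasurableSpace T] [BorelSpace T]

theorem measurableSet_Iic (a : T) : MeasurableSet (Iic a) := (hO.isClosed_Iic a).measurableSet

theorem measurableSet_Iio (a : T) : MeasurableSet (Iio a) := by
  rw [← Iic_sdiff_right]
  exact (hO.measurableSet_Iic a).diff (measurableSet_singleton a)

end IsOrderedTree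

variable [MeasurableSpace T]

/-- The point visited at time `t` by the exploration of the tree. -/
noncomputable def visited (ρ : T) (μ : Measure T) (t : ℝ) : T :=
  haveI : Nonempty T := ⟨ρ⟩
  lim (map (Subtype.val : discovered ρ μ t → T) atTop)

/-- Keeping `ρ` in `discovered` makes `atTop` a proper filter even for `t ≤ 0`. -/
instance (ρ : T) (μ : Measure T) (t : ℝ) : Nonempty (discovered ρ μ t) := ⟨⟨ρ, .inl rfl⟩⟩

variable {μ : Measure T}

/-- The one place where (Mes) itself is applied: visit intervals of distinct points are separated by
a gap. -/
theorem leave_lt_enter [BorelSpace T] [IsFiniteMeasure μ] (hO : IsOrderedTree ρ) (hM : Mes μ)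
    {a b : T} (h : a < b) : leave μ a < enter μ b := by
  have h1 : Iio b = Iic a ∪ {c | a < c ∧ c < b} := by
    ext c; simp only [mem_Iio, mem_union, mem_Iic, mem_ofPred_eq]
    constructor
    · intro hc; rcases le_or_gt c a with h' | h'
      · exact .inl h'
      · exact .inr ⟨h', hc⟩
    · rintro (hc | hc)
      · exact hc.trans_lt h
      · exact hc.2
  have h2 : Disjoint (Iic a) {c | a < c ∧ c < b} := by
    rw [Set.disjoint_left]; intro c hc hc'
    exact absurd hc (not_le.2 hc'.1)
  have h3 := measureReal_union' (μ := μ) h2 (hO.measurableSet_Iic a)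
  have h4 : 0 < μ.real {c | a < c ∧ c < b} := ENNReal.toReal_pos (hM a b h).ne' (measure_ne_top _ _)
  unfold leave enter
  rw [h1, h3]
  linarith

/-! ### The exploration process: left continuity, contour property, right limits. -/

section Exploration

variable [CompactSpace T] (hO : IsOrderedTree ρ)
include hO

theorem tendsto_visited (t : ℝ) :
    Tendsto (Subtype.val : discovered ρ μ t → T) atTop (𝓝 (visited ρ μ t)) := by
  have hc : IsContour ρ (Subtype.val : discovered ρ μ t → T) :=
    fun a b c hab hbc => hO.isContour_id a b c hab hbc
  have : Nonempty T := ⟨ρ⟩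
  exact le_nhds_lim (hc.exists_tendsto exists_between_of_atTop)

/-- Closed conditions need only be checked on discovered points beyond some `y`. -/
theorem visited_mem {C : Set T} (hC : IsClosed C) {t : ℝ} {y : T} (hy : y ∈ discovered ρ μ t)
    (h : ∀ x ∈ discovered ρ μ t, y ≤ x → x ∈ C) : visited ρ μ t ∈ C :=
  hC.mem_of_tendsto (tendsto_visited hO t)
    (eventually_atTop.2 ⟨⟨y, hy⟩, fun x hx => h x x.2 hx⟩)

theorem visited_mem' {C : Set T} (hC : IsClosed C) {t : ℝ}
    (h : ∀ x ∈ discovered ρ μ t, x ∈ C) : visited ρ μ t ∈ C :=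
  visited_mem hO hC (y := ρ) (.inl rfl) fun x hx _ => h x hx

/-- Beyond some discovered `y`, all points discovered before `t` are close to the limit. As `enter μ
y < t` is strict unless `y = ρ`, this `y` is already discovered at times `s` slightly below `t`. -/
theorem tendsto_visited_nhdsLE (t : ℝ) :
    Tendsto (visited ρ μ) (𝓝[≤] t) (𝓝 (visited ρ μ t)) := by
  rw [Metric.tendsto_nhds]
  intro ε hε
  obtain ⟨⟨y, hy⟩, H⟩ := eventually_atTop.1
    (Metric.tendsto_nhds.1 (tendsto_visited (μ := μ) hO t) (ε / 2) (by positivity))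
  have key : ∀ s ≤ t, y ∈ discovered ρ μ s → dist (visited ρ μ s) (visited ρ μ t) < ε := by
    intro s hst hys
    have : visited ρ μ s ∈ Metric.closedBall (visited ρ μ t) (ε / 2) :=
      visited_mem hO Metric.isClosed_closedBall hys fun x hx hyx =>
        (H ⟨x, discovered_mono hst hx⟩ hyx).le
    rw [Metric.mem_closedBall] at this
    linarith
  rcases hy with rfl | hy
  · filter_upwards [self_mem_nhdsWithin] with s hs
    exact key s hs (.inl rfl)
  · filter_upwards [Ioc_mem_nhdsLE hy] with s hs
    exact key s hs.2 (.inr hs.1)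

theorem visited_of_nonpos {t : ℝ} (ht : t ≤ 0) : visited ρ μ t = ρ := by
  refine visited_mem' hO isClosed_singleton ?_
  rintro x (rfl | hx)
  · rfl
  · exact absurd hx (not_lt.2 (ht.trans (enter_nonneg x)))

variable [IsFiniteMeasure μ]

theorem visited_le {t : ℝ} {a : T} (h : t ≤ enter μ a) : visited ρ μ t ≤ a := by
  refine visited_mem' hO (hO.isClosed_Iic a) ?_
  rintro x (rfl | hx)
  · exact hO.root_le a
  · exact (lt_of_enter_lt (hx.trans_le h)).le

/-- If no new point is discovered between two times, the visited points agree. Otherwise late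
discovered points `a ≤ b ≤ c` satisfy the inequalities by (Or2), and these are closed in each
variable, so they pass to the three limits. -/
theorem isContour_visited : IsContour ρ (visited ρ μ) := by
  have above : ∀ {s r : ℝ}, s ≤ r → discovered ρ μ s ≠ discovered ρ μ r →
      ∃ y ∈ discovered ρ μ r, ∀ x ∈ discovered ρ μ s, x ≤ y := by
    intro s r hsr hne
    obtain ⟨y, hy, hys⟩ := not_subset.1 fun h => hne ((discovered_mono hsr).antisymm h)
    simp only [discovered, mem_ofPred_eq, not_or, not_lt] at hys
    refine ⟨y, hy, ?_⟩
    rintro x (rfl | hx)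
    · exact hO.root_le y
    · exact (lt_of_enter_lt (hx.trans_le hys.2)).le
  intro s r t hsr hrt
  by_cases h1 : discovered ρ μ s = discovered ρ μ r
  · have : visited ρ μ s = visited ρ μ r := by unfold visited; rw [h1]
    rw [this, gromov_self]
    exact ⟨gromov_le_left _ _ _, le_rfl⟩
  by_cases h2 : discovered ρ μ r = discovered ρ μ t
  · have : visited ρ μ r = visited ρ μ t := by unfold visited; rw [h2]
    rw [this, gromov_self]
    exact ⟨le_rfl, gromov_le_right _ _ _⟩
  obtain ⟨y, hy, hy'⟩ := above hsr h1
  obtain ⟨z, hz, hz'⟩ := above hrt h2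
  refine visited_mem hO (C := {c | gromov ρ (visited ρ μ s) c ≤
    gromov ρ (visited ρ μ s) (visited ρ μ r)} ∩ {c | gromov ρ (visited ρ μ s) c ≤
    gromov ρ (visited ρ μ r) c}) ((isClosed_le (by fun_prop) (by fun_prop)).inter
      (isClosed_le (by fun_prop) (by fun_prop))) hz fun c hc hzc => ?_
  refine visited_mem hO (C := {b | gromov ρ (visited ρ μ s) c ≤ gromov ρ (visited ρ μ s) b} ∩
    {b | gromov ρ (visited ρ μ s) c ≤ gromov ρ b c})
    ((isClosed_le (by fun_prop) (by fun_prop)).inter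
      (isClosed_le (by fun_prop) (by fun_prop))) hy fun b hb hyb => ?_
  refine visited_mem' hO
    (C := {a | gromov ρ a c ≤ gromov ρ a b} ∩ {a | gromov ρ a c ≤ gromov ρ b c})
    ((isClosed_le (by fun_prop) (by fun_prop)).inter
      (isClosed_le (by fun_prop) (by fun_prop))) fun a ha => ?_
  exact hO.isContour_id a b c ((hy' a ha).trans hyb) ((hz' b hb).trans hzc)

variable [BorelSpace T] (hM : Mes μ)
include hM

theorem visited_eq {t : ℝ} {a : T} (h1 : enter μ a ≤ t) (h2 : t ≤ leave μ a) :
    visited ρ μ t = a := by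
  -- If `a` is already discovered, it is the greatest discovered point. Otherwise `t = enter μ a`,
  -- but the strict ancestors of `a` are discovered, and points between a high ancestor and `a`
  -- descend from it.
  by_cases h : a ∈ discovered ρ μ t
  · refine visited_mem hO isClosed_singleton h ?_
    rintro x (rfl | hx) hax
    · exact le_antisymm (hO.root_le a) hax
    · refine le_antisymm (le_of_not_gt fun hlt => ?_) hax
      have := leave_lt_enter hO hM hlt
      linarith
  · simp only [discovered, mem_ofPred_eq, not_or, not_lt] at h
    obtain rfl : t = enter μ a := le_antisymm h.2 h1
    refine le_antisymm (visited_le hO le_rfl) (hO.le_of_le_gromov ?_)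
    have ha : 0 < dist ρ a := dist_pos.2 (Ne.symm h.1)
    refine le_of_forall_lt_imp_le_of_dense fun r hr => ?_
    obtain ⟨c, hc, hca⟩ := hO.exists_ancestor a (max r 0) (le_max_right _ _) (max_le hr.le ha.le)
    have hclt : dist ρ c < dist ρ a := by rw [hc]; exact max_lt hr ha
    have hcle : c < a := lt_of_le_of_ne (hO.le_of_gromov_eq _ _ hca) (by rintro rfl; simp at hclt)
    have hcd : c ∈ discovered ρ μ (enter μ a) :=
      .inr ((enter_le_leave c).trans_lt (leave_lt_enter hO hM hcle))
    refine visited_mem hO (C := {x | r ≤ gromov ρ a x}) (isClosed_le (by fun_prop) (by fun_prop))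
      hcd fun x hx hcx => ?_
    have hxa : x ≤ a := by
      rcases hx with rfl | hx
      · exact hO.root_le a
      · exact (lt_of_enter_lt hx).le
    have := (hO.isContour_id c x a hcx hxa).2
    simp only [id] at this
    rw [mem_ofPred_eq, gromov_comm]
    have := le_max_left r 0
    linarith

theorem visited_enter (a : T) : visited ρ μ (enter μ a) = a :=
  visited_eq hO hM le_rfl (enter_le_leave a)

/-- The exploration has right limits, and its height has no positive jumps. -/
theorem exists_tendsto_visited_nhdsGT (t : ℝ) :
    ∃ τ, Tendsto (visited ρ μ) (𝓝[>] t) (𝓝 τ) ∧ dist ρ τ ≤ dist ρ (visited ρ μ t) := by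
  have hc := isContour_visited (μ := μ) hO
  obtain ⟨τ, hτ⟩ := hc.exists_tendsto (exists_between_of_nhdsGT t)
  refine ⟨τ, hτ, ?_⟩
  by_contra! hlt
  -- Take an ancestor `c` of `τ` at a height `r` between the two; just after `t` only descendants of
  -- `c` are visited. If `c` was entered by time `t`, the point visited at `t` also descends from
  -- `c`, so it is too high. If not, only `c` itself is visited just after `t`, so `τ = c` is too
  -- low.
  obtain ⟨r, hr1, hr2⟩ := exists_between hlt
  obtain ⟨c, hcr, hcτ⟩ := hO.exists_ancestor τ r (dist_nonneg.trans hr1.le) hr2.le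
  have h1 : ∀ᶠ s in 𝓝[>] t, r ≤ gromov ρ c (visited ρ μ s) := by
    have : Tendsto (fun s => gromov ρ τ (visited ρ μ s)) (𝓝[>] t) (𝓝 (gromov ρ τ τ)) :=
      ((continuous_const.gromov ρ continuous_id).tendsto τ).comp hτ
    rw [gromov_self] at this
    filter_upwards [this.eventually_const_lt hr2] with s hs
    have := hO.min_le c τ (visited ρ μ s)
    rwa [hcτ, hcr, min_eq_left hs.le] at this
  rcases le_or_gt (enter μ c) t with h2 | h2
  · obtain ⟨s, hs, hts⟩ := (h1.and self_mem_nhdsWithin).exists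
    have h3 := (hc _ _ s h2 (le_of_lt hts)).1
    rw [visited_enter hO hM] at h3
    have h4 := gromov_le_right ρ c (visited ρ μ t)
    linarith
  · have h3 : ∀ᶠ s in 𝓝[>] t, visited ρ μ s = c := by
      filter_upwards [h1, Ioo_mem_nhdsGT h2] with s hs hs2
      refine le_antisymm (visited_le hO hs2.2.le) (hO.le_of_le_gromov ?_)
      rwa [hcr]
    have h4 : Tendsto (visited ρ μ) (𝓝[>] t) (𝓝 c) :=
      tendsto_const_nhds.congr' (h3.mono fun s hs => hs.symm)
    rw [tendsto_nhds_unique hτ h4] at hr2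
    linarith

/-- The witness is the first visit of an ancestor of the point visited at `t`, slightly above the
branching height: it is not an ancestor of the point visited at `s`, so it cannot be entered before
`s`. The slack is needed because the infimum of the height need not be attained. -/
theorem exists_dist_visited_lt {s t : ℝ} (hst : s ≤ t) {x : ℝ}
    (hx : gromov ρ (visited ρ μ s) (visited ρ μ t) < x) :
    ∃ r ∈ Icc s t, dist ρ (visited ρ μ r) < x := by
  have hc := isContour_visited (μ := μ) hO
  rcases lt_or_ge (dist ρ (visited ρ μ t)) x with h | h
  · exact ⟨t, ⟨hst, le_rfl⟩, h⟩
  obtain ⟨r, hr1, hr2⟩ := exists_between hx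
  obtain ⟨c, hcr, hct⟩ := hO.exists_ancestor (visited ρ μ t) r
    ((gromov_nonneg _ _ _).trans hr1.le) (hr2.le.trans h)
  refine ⟨enter μ c, ⟨?_, ?_⟩, by rwa [visited_enter hO hM, hcr]⟩
  · by_contra! hlt
    have h1 := (hc _ s t hlt.le hst).1
    rw [visited_enter hO hM] at h1
    have h2 := hO.min_le (visited ρ μ s) c (visited ρ μ t)
    rw [hct, hcr] at h2
    rw [hct, hcr, gromov_comm] at h1
    rw [min_eq_right h1] at h2
    linarith
  · by_contra! hlt
    have : c = visited ρ μ t := le_antisymm (hO.le_of_gromov_eq _ _ hct) (visited_le hO hlt.le)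
    rw [← this, hcr] at h
    linarith

end Exploration

end OrderedTree

/-! ### Countable cofinality and the measure of lower and upper sets. -/

section Cofinal

/-- Applied to `enter μ`, this turns lower sets of `T` into countable unions of sets `Iic a`, for
measurability and continuity of measure. -/
theorem exists_seq_cofinal {α : Type*} [LinearOrder α] {f : α → ℝ} (hf : StrictMono f)
    {S : Set α} (hS : S.Nonempty) (hb : BddAbove (f '' S)) :
    ∃ u : ℕ → α, (∀ n, u n ∈ S) ∧ S ⊆ ⋃ n, Iic (u n) := by
  by_cases hmax : ∃ a ∈ S, ∀ x ∈ S, x ≤ a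
  · obtain ⟨a, ha, hmax⟩ := hmax
    exact ⟨fun _ => a, fun _ => ha, fun x hx => mem_iUnion.2 ⟨0, hmax x hx⟩⟩
  push Not at hmax
  obtain ⟨v, -, hv, hvS⟩ := exists_seq_tendsto_sSup (hS.image f) hb
  choose u hu huv using hvS
  refine ⟨u, hu, fun x hx => ?_⟩
  obtain ⟨y, hy, hxy⟩ := hmax x hx
  have h1 : f x < sSup (f '' S) := (hf hxy).trans_le (le_csSup hb ⟨y, hy, rfl⟩)
  obtain ⟨n, hn⟩ := (hv.eventually_const_lt h1).exists
  rw [← huv n] at hn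
  exact mem_iUnion.2 ⟨n, (hf.lt_iff_lt.1 hn).le⟩

theorem exists_seq_coinitial {α : Type*} [LinearOrder α] {f : α → ℝ} (hf : StrictMono f)
    {S : Set α} (hS : S.Nonempty) (hb : BddBelow (f '' S)) :
    ∃ u : ℕ → α, (∀ n, u n ∈ S) ∧ S ⊆ ⋃ n, Ici (u n) := by
  obtain ⟨b, hb⟩ := hb
  obtain ⟨u, hu, huS⟩ := exists_seq_cofinal (α := αᵒᵈ) (f := fun x => -f (OrderDual.ofDual x))
    (S := OrderDual.ofDual ⁻¹' S) (fun x y h => neg_lt_neg (hf h)) hS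
    ⟨-b, by rintro _ ⟨x, hx, rfl⟩; exact neg_le_neg (hb ⟨x, hx, rfl⟩)⟩
  refine ⟨fun n => OrderDual.ofDual (u n), hu, fun x hx => ?_⟩
  obtain ⟨n, hn⟩ := mem_iUnion.1 (huS (show OrderDual.toDual x ∈ _ from hx))
  exact mem_iUnion.2 ⟨n, hn⟩

end Cofinal

section Measure

variable {T : Type*} [MetricSpace T] [LinearOrder T] [MeasurableSpace T] [BorelSpace T]
  {ρ : T} {μ : Measure T} [IsFiniteMeasure μ] (hO : IsOrderedTree ρ) (hM : Mes μ)
include hO hM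

theorem strictMono_enter : StrictMono (enter μ) := fun a _ h =>
  (enter_le_leave a).trans_lt (leave_lt_enter hO hM h)

theorem measurableSet_of_isLowerSet {S : Set T} (hS : IsLowerSet S) : MeasurableSet S := by
  rcases S.eq_empty_or_nonempty with rfl | hne
  · exact MeasurableSet.empty
  obtain ⟨u, hu, hSu⟩ := exists_seq_cofinal (strictMono_enter hO hM) hne (bddAbove_enter S)
  have : S = ⋃ n, Iic (u n) := hSu.antisymm (iUnion_subset fun n x hx => hS hx (hu n))
  rw [this]
  exact MeasurableSet.iUnion fun n => hO.measurableSet_Iic _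

theorem measurable_of_monotone {f : T → ℝ} (hf : Monotone f) : Measurable f :=
  measurable_of_Iic fun _ => measurableSet_of_isLowerSet hO hM fun _ _ hba ha => (hf hba).trans ha

theorem measure_le_of_forall_leave_le {S : Set T} {t : ℝ} (h : ∀ x ∈ S, leave μ x ≤ t) :
    μ S ≤ ENNReal.ofReal t := by
  rcases S.eq_empty_or_nonempty with rfl | hne
  · simp
  obtain ⟨u, hu, hSu⟩ := exists_seq_cofinal (strictMono_enter hO hM) hne (bddAbove_enter S)
  refine (measure_mono hSu).trans ?_
  rw [Directed.measure_iUnion]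
  · refine iSup_le fun n => ?_
    rw [← ofReal_measureReal]
    exact ENNReal.ofReal_le_ofReal (h _ (hu n))
  · intro i j
    rcases le_total (u i) (u j) with h | h
    · exact ⟨j, Iic_subset_Iic.2 h, le_rfl⟩
    · exact ⟨i, le_rfl, Iic_subset_Iic.2 h⟩

theorem measure_le_of_forall_le_enter {S : Set T} {t : ℝ} (h : ∀ x ∈ S, t ≤ enter μ x) :
    μ S ≤ ENNReal.ofReal (μ.real univ - t) := by
  rcases S.eq_empty_or_nonempty with rfl | hne
  · simp
  obtain ⟨u, hu, hSu⟩ :=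
    exists_seq_coinitial (strictMono_enter hO hM) hne (bddBelow_enter S)
  refine (measure_mono hSu).trans ?_
  rw [Directed.measure_iUnion]
  · refine iSup_le fun n => ?_
    rw [← ofReal_measureReal, ← compl_Iio, measureReal_compl (hO.measurableSet_Iio _)]
    exact ENNReal.ofReal_le_ofReal (sub_le_sub_left (h _ (hu n)) _)
  · intro i j
    rcases le_total (u i) (u j) with h | h
    · exact ⟨i, le_rfl, Ici_subset_Ici.2 h⟩
    · exact ⟨j, Ici_subset_Ici.2 h, le_rfl⟩

end Measure

/-! ### Lebesgue measure as the law of a uniform visit time. -/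

section Uniformize

variable {T : Type*} [LinearOrder T] [MeasurableSpace T] {ρ : T} {μ : Measure T}
  [IsFiniteMeasure μ]

/-- The times at which `x` is first visited, parametrised affinely by `[0, 1]`. -/
noncomputable def visitTime (μ : Measure T) (z : T × ℝ) : ℝ :=
  enter μ z.1 + z.2 * (leave μ z.1 - enter μ z.1)

theorem visitTime_mem {x : T} {u : ℝ} (hu : u ∈ Icc (0 : ℝ) 1) :
    visitTime μ (x, u) ∈ Icc (enter μ x) (leave μ x) := by
  have := enter_le_leave (μ := μ) x
  simp only [visitTime, mem_Icc]
  constructor <;> nlinarith [hu.1, hu.2]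

variable [MetricSpace T] [BorelSpace T] (hO : IsOrderedTree ρ) (hM : Mes μ)
include hO hM

theorem measurable_visitTime : Measurable (visitTime μ) := by
  have h1 := measurable_of_monotone hO hM (enter_mono (μ := μ))
  have h2 := measurable_of_monotone hO hM (leave_mono (μ := μ))
  exact (h1.comp measurable_fst).add
    (measurable_snd.mul ((h2.comp measurable_fst).sub (h1.comp measurable_fst)))

/-- If `t` is in the visit interval of `a`, split the event into the points below `a` and a fraction
`c` of the atom at `a`. If `t` is in no such interval, the points entered by `t` have mass at most
`t`, and their complement has mass at most `μ(T) - t`. -/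
theorem measure_visitTime_le {t : ℝ} (ht : t ∈ Icc 0 (μ.real univ)) :
    (μ.prod volume) ({z | visitTime μ z ≤ t} ∩ univ ×ˢ Icc 0 1) = ENNReal.ofReal t := by
  by_cases hF : ∃ a, t ∈ Icc (enter μ a) (leave μ a)
  · obtain ⟨a, ha⟩ := hF
    set m := leave μ a - enter μ a with hm
    have hm0 : 0 ≤ m := sub_nonneg.2 (enter_le_leave a)
    have hma : μ {a} = ENNReal.ofReal m := by
      rw [← ofReal_measureReal, hm]
      congr 1
      have := measureReal_sdiff (μ := μ) (s₁ := Iic a) (s₂ := Iio a) Iio_subset_Iic_self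
        (hO.measurableSet_Iio a)
      rw [← Iic_sdiff_Iio_same] at *
      exact this
    -- When `{a}` has no mass, the condition does not constrain `u`, so `c = 1`.
    obtain ⟨c, hc, hcm, hciff⟩ : ∃ c ∈ Icc (0 : ℝ) 1, c * m = t - enter μ a ∧
        ∀ u ∈ Icc (0 : ℝ) 1, enter μ a + u * m ≤ t ↔ u ≤ c := by
      rcases eq_or_lt_of_le hm0 with h0 | h0
      · have : t = enter μ a := le_antisymm (by linarith [ha.2]) ha.1
        refine ⟨1, ⟨zero_le_one, le_rfl⟩, by rw [← h0]; linarith, fun u hu => ?_⟩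
        rw [← h0, mul_zero, add_zero, this]
        simp [hu.2]
      · refine ⟨(t - enter μ a) / m, ⟨div_nonneg (by linarith [ha.1]) hm0,
          (div_le_one h0).2 (by linarith [ha.2])⟩, div_mul_cancel₀ _ h0.ne', fun u hu => ?_⟩
        rw [le_div_iff₀ h0]
        constructor <;> intro h <;> linarith
    have hset : {z | visitTime μ z ≤ t} ∩ univ ×ˢ Icc 0 1 =
        Iio a ×ˢ Icc 0 1 ∪ {a} ×ˢ Icc 0 c := by
      ext ⟨x, u⟩
      simp only [mem_inter_iff, mem_ofPred_eq, mem_prod, mem_univ, true_and, mem_union, mem_Iio,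
        mem_singleton_iff]
      constructor
      · rintro ⟨h1, hu⟩
        rcases lt_trichotomy x a with h | rfl | h
        · exact .inl ⟨h, hu⟩
        · exact .inr ⟨rfl, hu.1, (hciff u hu).1 h1⟩
        · have h2 := (visitTime_mem (μ := μ) (x := x) hu).1
          have h3 := leave_lt_enter hO hM h
          linarith [ha.2]
      · rintro (⟨h, hu⟩ | ⟨rfl, hu⟩)
        · have h2 := (visitTime_mem (μ := μ) (x := x) hu).2
          have h3 := leave_lt_enter hO hM h
          exact ⟨by linarith [ha.1], hu⟩
        · have hu' : u ∈ Icc (0 : ℝ) 1 := ⟨hu.1, hu.2.trans hc.2⟩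
          exact ⟨(hciff u hu').2 hu.2, hu'⟩
    rw [hset, measure_union _ ((measurableSet_singleton a).prod measurableSet_Icc),
      Measure.prod_prod, Measure.prod_prod, Real.volume_Icc, Real.volume_Icc, hma,
      ← ofReal_measureReal (μ := μ) (s := Iio a), ← ENNReal.ofReal_mul measureReal_nonneg,
      ← ENNReal.ofReal_mul hm0, ← ENNReal.ofReal_add]
    · congr 1
      change enter μ a * (1 - 0) + m * (c - 0) = t
      linarith
    · simp [measureReal_nonneg]
    · simp only [sub_zero]; exact mul_nonneg hm0 hc.1
    · rw [Set.disjoint_left]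
      rintro ⟨x, u⟩ h1 h2
      exact absurd h2.1 (ne_of_lt h1.1)
  · have hF' : ∀ a, enter μ a ≤ t → leave μ a ≤ t := fun a h1 =>
      le_of_not_ge fun h2 => hF ⟨a, h1, h2⟩
    set S : Set T := {x | enter μ x ≤ t} with hS
    have hSm : MeasurableSet S := measurableSet_of_isLowerSet hO hM
      fun a b hba ha => (enter_mono hba).trans ha
    have hset : {z | visitTime μ z ≤ t} ∩ univ ×ˢ Icc 0 1 = S ×ˢ Icc (0 : ℝ) 1 := by
      ext ⟨x, u⟩
      simp only [mem_inter_iff, mem_ofPred_eq, mem_prod, mem_univ, true_and, hS]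
      refine and_congr_left fun hu => ?_
      have h2 := visitTime_mem (μ := μ) (x := x) hu
      exact ⟨fun h => h2.1.trans h, fun h => h2.2.trans (hF' x h)⟩
    rw [hset, Measure.prod_prod, Real.volume_Icc, sub_zero, ENNReal.ofReal_one, mul_one]
    refine le_antisymm (measure_le_of_forall_leave_le hO hM fun x hx => hF' x hx) ?_
    have h1 : μ Sᶜ ≤ ENNReal.ofReal (μ.real univ - t) :=
      measure_le_of_forall_le_enter hO hM fun x hx => (not_le.1 (show ¬enter μ x ≤ t from hx)).le
    have h2 := measureReal_compl (μ := μ) hSm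
    have h3 : μ.real Sᶜ ≤ μ.real univ - t :=
      ENNReal.toReal_le_of_le_ofReal (by linarith [ht.2]) h1
    rw [← ofReal_measureReal]
    exact ENNReal.ofReal_le_ofReal (by linarith)

theorem map_visitTime :
    (μ.prod (volume.restrict (Icc (0 : ℝ) 1))).map (visitTime μ) =
      volume.restrict (Icc 0 (μ.real univ)) := by
  have hm := measurable_visitTime hO hM
  have hν : μ.prod (volume.restrict (Icc (0 : ℝ) 1)) =
      (μ.prod volume).restrict (univ ×ˢ Icc 0 1) := by
    rw [← Measure.prod_restrict, Measure.restrict_univ]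
  refine Measure.ext_of_Iic _ _ fun t => ?_
  rw [Measure.map_apply hm measurableSet_Iic, hν, Measure.restrict_apply (hm measurableSet_Iic),
    Measure.restrict_apply measurableSet_Iic]
  have h0 : (0 : ℝ) ≤ μ.real univ := measureReal_nonneg
  rcases lt_or_ge t 0 with ht | ht
  · have e1 : visitTime μ ⁻¹' Iic t ∩ univ ×ˢ Icc 0 1 = ∅ := by
      refine eq_empty_of_forall_notMem ?_
      rintro ⟨x, u⟩ ⟨h1, -, h2⟩
      have h3 := (visitTime_mem (μ := μ) (x := x) h2).1
      have h4 := enter_nonneg (μ := μ) x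
      have h5 : visitTime μ (x, u) ≤ t := h1
      linarith
    have e2 : Iic t ∩ Icc 0 (μ.real univ) = ∅ := by
      refine eq_empty_of_forall_notMem ?_
      rintro x ⟨h1, h2, -⟩
      have h5 : x ≤ t := h1
      linarith
    rw [e1, e2, measure_empty, measure_empty]
  rcases le_or_gt t (μ.real univ) with ht' | ht'
  · have e2 : Iic t ∩ Icc 0 (μ.real univ) = Icc 0 t := by
      ext x
      simp only [mem_inter_iff, mem_Iic, mem_Icc]
      constructor
      · rintro ⟨h1, h2, -⟩; exact ⟨h2, h1⟩
      · rintro ⟨h1, h2⟩; exact ⟨h2, h1, h2.trans ht'⟩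
    rw [e2, Real.volume_Icc, sub_zero]
    exact measure_visitTime_le hO hM ⟨ht, ht'⟩
  · have e1 : visitTime μ ⁻¹' Iic t ∩ univ ×ˢ Icc 0 1 = univ ×ˢ Icc 0 1 := by
      refine inter_eq_right.2 ?_
      rintro ⟨x, u⟩ ⟨-, h2⟩
      have h3 := (visitTime_mem (μ := μ) (x := x) h2).2
      have h4 := leave_le (μ := μ) x
      exact (h3.trans h4).trans ht'.le
    have e2 : Iic t ∩ Icc 0 (μ.real univ) = Icc 0 (μ.real univ) :=
      inter_eq_right.2 fun x hx => hx.2.trans ht'.le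
    rw [e1, e2, Real.volume_Icc, Measure.prod_prod, Real.volume_Icc]
    simp

end Uniformize

/-! ### Existence: the height of the exploration codes the tree. -/

section Existence

variable {T : Type*} [MetricSpace T] [CompactSpace T] [LinearOrder T] [MeasurableSpace T]
  [BorelSpace T] {ρ : T} {μ : Measure T} [IsFiniteMeasure μ]
  (hO : IsOrderedTree ρ) (hM : Mes μ)

/-- The height of the point visited by the exploration of the tree. -/
noncomputable def heightOf : HeightFunction where
  lifetime := μ.real univ
  lifetime_nonneg := measureReal_nonneg
  toFun t := dist ρ (visited ρ μ t)
  nonneg _ := dist_nonneg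
  left_cont t := by
    have h1 : Tendsto (Subtype.val : Icc 0 (μ.real univ) → ℝ) (𝓝[≤] t) (𝓝[≤] (t : ℝ)) :=
      tendsto_nhdsWithin_iff.2 ⟨(continuous_subtype_val.tendsto t).mono_left nhdsWithin_le_nhds,
        eventually_nhdsWithin_of_forall fun s hs => hs⟩
    exact tendsto_const_nhds.dist ((tendsto_visited_nhdsLE hO (t : ℝ)).comp h1)
  right_lim t _ := by
    obtain ⟨τ, hτ, hle⟩ := exists_tendsto_visited_nhdsGT hO hM (t : ℝ)
    have h1 : Tendsto (Subtype.val : Icc 0 (μ.real univ) → ℝ) (𝓝[>] t) (𝓝[>] (t : ℝ)) :=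
      tendsto_nhdsWithin_iff.2 ⟨(continuous_subtype_val.tendsto t).mono_left nhdsWithin_le_nhds,
        eventually_nhdsWithin_of_forall fun s hs => hs⟩
    exact ⟨dist ρ τ, hle, tendsto_const_nhds.dist (hτ.comp h1)⟩
  map_zero := by rw [visited_of_nonpos hO le_rfl, dist_self]
  map_zero_right := by
    obtain ⟨τ, hτ, hle⟩ := exists_tendsto_visited_nhdsGT hO hM (0 : ℝ)
    rw [visited_of_nonpos hO le_rfl, dist_self] at hle
    have h1 : Tendsto (Subtype.val : Icc 0 (μ.real univ) → ℝ)
        (𝓝[>] ⟨0, le_rfl, measureReal_nonneg⟩) (𝓝[>] (0 : ℝ)) :=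
      tendsto_nhdsWithin_iff.2 ⟨(continuous_subtype_val.tendsto _).mono_left nhdsWithin_le_nhds,
        eventually_nhdsWithin_of_forall fun s hs => hs⟩
    have h2 : Tendsto (fun t : Icc 0 (μ.real univ) => dist ρ (visited ρ μ t))
        (𝓝[>] ⟨0, le_rfl, measureReal_nonneg⟩) (𝓝 (dist ρ τ)) :=
      tendsto_const_nhds.dist (hτ.comp h1)
    rwa [le_antisymm hle dist_nonneg] at h2

/-- The contour property bounds the infimum below; first visits of ancestors just above the
branching point bound it above. -/
theorem minBetween_heightOf (s t : Icc 0 (heightOf hO hM).lifetime) :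
    (heightOf hO hM).minBetween s t = gromov ρ (visited ρ μ s) (visited ρ μ t) := by
  wlog hst : s ≤ t generalizing s t
  · rw [gromov_comm, ← this t s (le_of_not_ge hst), HeightFunction.minBetween,
      HeightFunction.minBetween, uIcc_comm]
  refine le_antisymm (le_of_forall_gt_imp_ge_of_dense fun x hx => ?_)
    ((heightOf hO hM).le_minBetween fun r hr => ?_)
  · obtain ⟨r, hr, hrx⟩ := exists_dist_visited_lt hO hM (show (s : ℝ) ≤ t from hst) hx
    have hr' : r ∈ Icc 0 (heightOf hO hM).lifetime := ⟨s.2.1.trans hr.1, hr.2.trans t.2.2⟩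
    refine le_trans ((heightOf hO hM).minBetween_le (r := ⟨r, hr'⟩) ?_) hrx.le
    rw [uIcc_of_le hst]
    exact hr
  · rw [uIcc_of_le hst] at hr
    exact ((isContour_visited hO s r t hr.1 hr.2).1).trans (gromov_le_right _ _ _)

theorem treeDist_heightOf (s t : Icc 0 (heightOf hO hM).lifetime) :
    (heightOf hO hM).treeDist s t = dist (visited ρ μ s) (visited ρ μ t) := by
  rw [HeightFunction.treeDist, minBetween_heightOf, dist_eq_gromov ρ]
  rfl

theorem enter_mem_Icc (a : T) : enter μ a ∈ Icc 0 (heightOf hO hM).lifetime :=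
  ⟨enter_nonneg a, (enter_le_leave a).trans (leave_le a)⟩

/-- The isometry from an ordered tree onto the tree coded by the height of its exploration. -/
noncomputable def toTree : T ≃ᵢ (heightOf hO hM).Tree :=
  IsometryEquiv.mk (Equiv.ofBijective (fun a => (heightOf hO hM).proj ⟨_, enter_mem_Icc hO hM a⟩)
    ⟨fun a b h => by
      rw [HeightFunction.proj_eq_proj_iff, treeDist_heightOf] at h
      simpa only [visited_enter hO hM, dist_eq_zero] using h,
    fun σ => by
      obtain ⟨t, rfl⟩ := (heightOf hO hM).proj_surjective σ
      refine ⟨visited ρ μ t, ?_⟩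
      rw [HeightFunction.proj_eq_proj_iff, treeDist_heightOf]
      simp only [visited_enter hO hM, dist_self]⟩)
    (Isometry.of_dist_eq fun a b => by
      change dist ((heightOf hO hM).proj _) ((heightOf hO hM).proj _) = _
      rw [HeightFunction.dist_proj, treeDist_heightOf]
      simp only [visited_enter hO hM])

theorem toTree_eq_iff (a : T) (t : Icc 0 (heightOf hO hM).lifetime) :
    (heightOf hO hM).proj t = toTree hO hM a ↔ visited ρ μ t = a := by
  change (heightOf hO hM).proj t = (heightOf hO hM).proj _ ↔ _
  rw [HeightFunction.proj_eq_proj_iff, treeDist_heightOf, dist_eq_zero]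
  simp only [visited_enter hO hM]

theorem toTree_visited (t : Icc 0 (heightOf hO hM).lifetime) :
    toTree hO hM (visited ρ μ t) = (heightOf hO hM).proj t :=
  ((toTree_eq_iff hO hM _ t).2 rfl).symm

theorem bddBelow_visits (h : HeightFunction) (σ : h.Tree) :
    BddBelow {x : ℝ | ∃ t : Icc (0 : ℝ) h.lifetime, (t : ℝ) = x ∧ h.proj t = σ} :=
  ⟨0, by rintro _ ⟨t, rfl, -⟩; exact t.2.1⟩

theorem nonempty_visits (h : HeightFunction) (σ : h.Tree) :
    {x : ℝ | ∃ t : Icc (0 : ℝ) h.lifetime, (t : ℝ) = x ∧ h.proj t = σ}.Nonempty := by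
  obtain ⟨t, rfl⟩ := h.proj_surjective σ
  exact ⟨t, t, rfl, rfl⟩

theorem firstVisit_toTree_le (a : T) :
    (heightOf hO hM).firstVisit (toTree hO hM a) ≤ enter μ a :=
  csInf_le (bddBelow_visits _ _) ⟨⟨_, enter_mem_Icc hO hM a⟩, rfl, rfl⟩

/-- A time between some visit of `a` and `enter μ a` also visits `a`: the contour property gives a
descendant of `a`, and before `enter μ a` only points `≤ a` are visited. -/
theorem leave_le_firstExit_toTree (a : T) :
    leave μ a ≤ (heightOf hO hM).firstExit (toTree hO hM a) := by
  refine le_csInf (insert_nonempty _ _) ?_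
  rintro x (rfl | ⟨t, rfl, h1, h2⟩)
  · exact leave_le a
  by_contra! hlt
  refine h2 ((toTree_eq_iff hO hM a t).2 ?_)
  rcases le_or_gt (enter μ a) t with h3 | h3
  · exact visited_eq hO hM h3 hlt.le
  obtain ⟨_, ⟨s, rfl, hs⟩, hst⟩ := exists_lt_of_csInf_lt (nonempty_visits _ _) h1
  rw [toTree_eq_iff] at hs
  have h4 := (isContour_visited (μ := μ) hO s t _ hst.le h3.le).1
  rw [visited_enter hO hM, hs, gromov_self] at h4
  exact le_antisymm (visited_le hO h3.le) (hO.le_of_le_gromov h4)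

theorem toTree_le {a b : T} (hab : a ≤ b) : toTree hO hM a ≤ toTree hO hM b := by
  rcases eq_or_lt_of_le hab with rfl | hab
  · exact le_refl ((heightOf hO hM).firstVisit _)
  refine (firstVisit_toTree_le hO hM a).trans (le_csInf (nonempty_visits _ _) ?_)
  rintro _ ⟨t, rfl, ht⟩
  rw [toTree_eq_iff] at ht
  by_contra! hlt
  have := visited_le (μ := μ) hO hlt.le
  rw [ht] at this
  exact this.not_gt hab

theorem measurable_visited :
    Measurable fun t : Icc 0 (heightOf hO hM).lifetime => visited ρ μ t := by
  have h1 : (fun t : Icc 0 (heightOf hO hM).lifetime => visited ρ μ t) =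
      (toTree hO hM).symm ∘ (heightOf hO hM).proj := by
    funext t
    simp [← toTree_visited hO hM t]
  rw [h1]
  exact (toTree hO hM).symm.continuous.measurable.comp (heightOf hO hM).measurable_proj

theorem map_visited :
    ((volume : Measure ℝ).comap
      (Subtype.val : Icc 0 (heightOf hO hM).lifetime → ℝ)).map
      (fun t : Icc 0 (heightOf hO hM).lifetime => visited ρ μ t) = μ := by
  set h := heightOf hO hM
  -- Measurability of `visited` is available only on `[0, M]`, so it is extended constantly outside.
  let P : ℝ → T := fun t => visited ρ μ (projIcc 0 h.lifetime h.lifetime_nonneg t)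
  have hP : Measurable P := (measurable_visited hO hM).comp continuous_projIcc.measurable
  have h1 : (fun t : Icc 0 h.lifetime => visited ρ μ t) = P ∘ Subtype.val := by
    funext t; simp [P]
  rw [h1, ← Measure.map_map hP measurable_subtype_coe, map_comap_subtype_coe measurableSet_Icc]
  change (volume.restrict (Icc 0 (μ.real univ))).map P = μ
  rw [← map_visitTime hO hM, Measure.map_map hP (measurable_visitTime hO hM)]
  have h2 : P ∘ visitTime μ =ᵐ[μ.prod (volume.restrict (Icc (0 : ℝ) 1))] Prod.fst := by
    have h3 : ∀ᵐ z ∂(μ.prod (volume.restrict (Icc (0 : ℝ) 1))), z.2 ∈ Icc (0 : ℝ) 1 :=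
      Measure.quasiMeasurePreserving_snd.ae (ae_restrict_mem measurableSet_Icc)
    filter_upwards [h3] with z hz
    have h4 := visitTime_mem (μ := μ) (x := z.1) hz
    have h5 : visitTime μ z ∈ Icc 0 h.lifetime :=
      ⟨(enter_nonneg _).trans h4.1, h4.2.trans (leave_le _)⟩
    simp only [P, Function.comp, projIcc_of_mem _ h5]
    exact visited_eq hO hM h4.1 h4.2
  rw [Measure.map_congr h2, Measure.map_fst_prod]
  simp

theorem treeMeasure_heightOf : (heightOf hO hM).treeMeasure = μ.map (toTree hO hM) := by
  have h1 : (heightOf hO hM).proj = toTree hO hM ∘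
      fun t : Icc 0 (heightOf hO hM).lifetime => visited ρ μ t := by
    funext t
    exact (toTree_visited hO hM t).symm
  have h2 := Measure.map_map (μ := (volume : Measure ℝ).comap
    (Subtype.val : Icc 0 (heightOf hO hM).lifetime → ℝ))
    (toTree hO hM).continuous.measurable (measurable_visited hO hM)
  rw [map_visited] at h2
  rw [h2, HeightFunction.treeMeasure, h1]

/-- A uniform visit time of `x` lies in the visit interval of `x`, so almost every time lies in that
of its own visited point. The exceptional set `N` is measurable and contains the times of latter
visit. -/
theorem isMinimal_heightOf : (heightOf hO hM).IsMinimal := by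
  set h := heightOf hO hM with hh
  let P : ℝ → T := fun t => visited ρ μ (projIcc 0 h.lifetime h.lifetime_nonneg t)
  have hP : Measurable P := (measurable_visited hO hM).comp continuous_projIcc.measurable
  have he := measurable_of_monotone hO hM (enter_mono (μ := μ))
  have hl := measurable_of_monotone hO hM (leave_mono (μ := μ))
  let N : Set ℝ := {t | enter μ (P t) ≤ t ∧ t ≤ leave μ (P t)}ᶜ
  have hN : MeasurableSet N :=
    ((measurableSet_le (he.comp hP) measurable_id).inter
      (measurableSet_le measurable_id (hl.comp hP))).compl
  have h0 : volume.restrict (Icc 0 (μ.real univ)) N = 0 := by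
    rw [← map_visitTime hO hM, Measure.map_apply (measurable_visitTime hO hM) hN]
    have h3 : ∀ᵐ z ∂(μ.prod (volume.restrict (Icc (0 : ℝ) 1))), z.2 ∈ Icc (0 : ℝ) 1 :=
      Measure.quasiMeasurePreserving_snd.ae (ae_restrict_mem measurableSet_Icc)
    refine measure_eq_zero_iff_ae_notMem.2 (h3.mono fun z hz' hz => hz ?_)
    have h4 := visitTime_mem (μ := μ) (x := z.1) hz'
    have h5 : visitTime μ z ∈ Icc 0 h.lifetime :=
      ⟨(enter_nonneg _).trans h4.1, h4.2.trans (leave_le _)⟩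
    have h6 : P (visitTime μ z) = z.1 := by
      simp only [P, projIcc_of_mem _ h5]
      exact visited_eq hO hM h4.1 h4.2
    change enter μ (P (visitTime μ z)) ≤ _ ∧ _ ≤ leave μ (P (visitTime μ z))
    rw [h6]
    exact h4
  rw [Measure.restrict_apply hN] at h0
  refine measure_mono_null ?_ h0
  rintro t ⟨ht, htF⟩
  refine ⟨fun h1 => htF (mem_iUnion.2 ⟨toTree hO hM (P t), ?_⟩), ht⟩
  exact ⟨(firstVisit_toTree_le hO hM _).trans h1.1,
    h1.2.trans (leave_le_firstExit_toTree hO hM _)⟩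

theorem equivalent_heightOf :
    Equivalent ρ μ (heightOf hO hM).root (heightOf hO hM).treeMeasure := by
  refine ⟨toTree hO hM, ?_, fun a b => toTree_le hO hM, treeMeasure_heightOf hO hM⟩
  exact ((toTree_eq_iff hO hM _ _).2 (visited_of_nonpos hO le_rfl)).symm

end Existence

/-! ### First visits for a general height function. -/

namespace HeightFunction

variable (h : HeightFunction)

theorem minBetween_eq_of_proj_eq {s t : Icc (0 : ℝ) h.lifetime} (hst : h.proj s = h.proj t) :
    h.minBetween s t = h.toFun t ∧ h.toFun s = h.toFun t := by
  rw [proj_eq_proj_iff, treeDist] at hst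
  have h1 : h.minBetween s t ≤ h.toFun s := h.minBetween_le left_mem_uIcc
  have h2 : h.minBetween s t ≤ h.toFun t := h.minBetween_le right_mem_uIcc
  constructor <;> linarith

theorem proj_eq_of_le {s t : Icc (0 : ℝ) h.lifetime} (hst : s ≤ t) (h1 : h.toFun s = h.toFun t)
    (h2 : ∀ r, s ≤ r → r ≤ t → h.toFun t ≤ h.toFun r) : h.proj s = h.proj t := by
  rw [proj_eq_proj_iff]
  refine le_antisymm ?_ (by rw [← h.dist_proj]; exact dist_nonneg)
  have : h.toFun t ≤ h.minBetween s t := h.le_minBetween fun r hr => by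
    rw [uIcc_of_le hst] at hr; exact h2 r hr.1 hr.2
  rw [treeDist]; linarith

theorem dist_root_proj (t : Icc (0 : ℝ) h.lifetime) : dist h.root (h.proj t) = h.toFun t := by
  have h1 : h.minBetween ⟨0, le_rfl, h.lifetime_nonneg⟩ t = 0 := by
    refine le_antisymm ?_ (h.le_minBetween fun r _ => h.nonneg r)
    have := h.minBetween_le (s := ⟨0, le_rfl, h.lifetime_nonneg⟩) (t := t) left_mem_uIcc
    rwa [h.map_zero] at this
  rw [root, dist_proj, treeDist, h.map_zero, h1]
  ring

theorem firstVisit_le (t : Icc (0 : ℝ) h.lifetime) : h.firstVisit (h.proj t) ≤ t :=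
  csInf_le (bddBelow_visits h _) ⟨t, rfl, rfl⟩

theorem firstVisit_nonneg (σ : h.Tree) : 0 ≤ h.firstVisit σ :=
  le_csInf (nonempty_visits h σ) (by rintro _ ⟨t, rfl, -⟩; exact t.2.1)

theorem firstVisit_le_lifetime (σ : h.Tree) : h.firstVisit σ ≤ h.lifetime := by
  obtain ⟨t, rfl⟩ := h.proj_surjective σ
  exact (h.firstVisit_le t).trans t.2.2

theorem firstVisit_le_firstExit (σ : h.Tree) : h.firstVisit σ ≤ h.firstExit σ := by
  refine le_csInf (insert_nonempty _ _) ?_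
  rintro x (rfl | ⟨t, rfl, h1, -⟩)
  · exact h.firstVisit_le_lifetime σ
  · exact h1.le

theorem bddBelow_exits (σ : h.Tree) : BddBelow (insert h.lifetime
    {x : ℝ | ∃ t : Icc (0 : ℝ) h.lifetime, (t : ℝ) = x ∧ h.firstVisit σ < x ∧ h.proj t ≠ σ}) :=
  ⟨0, by
    rintro x (rfl | ⟨t, rfl, -, -⟩)
    · exact h.lifetime_nonneg
    · exact t.2.1⟩

theorem firstExit_le_lifetime (σ : h.Tree) : h.firstExit σ ≤ h.lifetime :=
  csInf_le (h.bddBelow_exits σ) (mem_insert _ _)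

/-- The infimum in the definition of the first visit time is attained. -/
theorem exists_firstVisit (σ : h.Tree) :
    ∃ t : Icc (0 : ℝ) h.lifetime, (t : ℝ) = h.firstVisit σ ∧ h.proj t = σ := by
  obtain ⟨t₁, rfl⟩ := h.proj_surjective σ
  set l := h.firstVisit (h.proj t₁) with hl
  set c := h.toFun t₁ with hc
  have hl0 : 0 ≤ l := h.firstVisit_nonneg _
  rcases eq_or_lt_of_le (h.firstVisit_le t₁) with heq | hlt
  · exact ⟨t₁, heq.symm, rfl⟩
  have above : ∀ r : Icc (0 : ℝ) h.lifetime, l < r → r ≤ t₁ → c ≤ h.toFun r := by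
    intro r hr hrt
    obtain ⟨_, ⟨s, rfl, hs⟩, hsr⟩ := exists_lt_of_csInf_lt (nonempty_visits h _) hr
    rw [hc, ← (h.minBetween_eq_of_proj_eq hs).1]
    refine h.minBetween_le ?_
    rw [uIcc_of_le (show s ≤ t₁ from hsr.le.trans hrt)]
    exact ⟨hsr.le, hrt⟩
  -- the last time before `l` at which the height is at most `c`
  let A : Set ℝ := {x | ∃ t : Icc (0 : ℝ) h.lifetime, (t : ℝ) = x ∧ x ≤ l ∧ h.toFun t ≤ c}
  have hA0 : (0 : ℝ) ∈ A :=
    ⟨⟨0, le_rfl, h.lifetime_nonneg⟩, rfl, hl0, by rw [h.map_zero]; exact h.nonneg _⟩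
  have hAb : BddAbove A := ⟨l, by rintro _ ⟨t, rfl, ht, -⟩; exact ht⟩
  have hal : sSup A ≤ l := csSup_le ⟨0, hA0⟩ (by rintro _ ⟨t, rfl, ht, -⟩; exact ht)
  let a : Icc (0 : ℝ) h.lifetime :=
    ⟨sSup A, le_csSup hAb hA0, hal.trans (h.firstVisit_le_lifetime _)⟩
  have hat : a < t₁ := show sSup A < t₁ from hal.trans_lt hlt
  -- Left continuity carries the bound to the supremum of `A`.
  have hac : h.toFun a ≤ c := by
    by_contra! hgt
    have h1 : ∀ᶠ s in 𝓝[≤] a, c < h.toFun s := (h.left_cont a).eventually_const_lt hgt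
    rw [eventually_nhdsWithin_iff, Metric.eventually_nhds_iff] at h1
    obtain ⟨δ, hδ, H⟩ := h1
    obtain ⟨_, ⟨s, rfl, hsl, hsc⟩, hs⟩ := exists_lt_of_lt_csSup ⟨0, hA0⟩
      (show sSup A - δ < sSup A by linarith)
    have hsa : (s : ℝ) ≤ sSup A := le_csSup hAb ⟨s, rfl, hsl, hsc⟩
    refine (H (y := s) ?_ hsa).not_ge hsc
    change |(s : ℝ) - sSup A| < δ
    rw [abs_of_nonpos (by linarith)]
    linarith
  have habove : ∀ r, a < r → r ≤ t₁ → c ≤ h.toFun r := by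
    intro r har hrt
    rcases lt_or_ge l (r : ℝ) with h1 | h1
    · exact above r h1 hrt
    · by_contra! h2
      exact (show sSup A < r from har).not_ge (le_csSup hAb ⟨r, rfl, h1, h2.le⟩)
  -- The height is at least `c` just after `a`, and there is no positive jump at `a`.
  have hca : c ≤ h.toFun a := by
    obtain ⟨x, hx, hlim⟩ := h.right_lim a (lt_of_lt_of_le hat t₁.2.2)
    have : (𝓝[>] a).NeBot := nhdsGT_neBot_of_exists_gt ⟨t₁, hat⟩
    refine le_trans (ge_of_tendsto hlim ?_) hx
    filter_upwards [Ioo_mem_nhdsGT hat] with r hr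
    exact habove r hr.1 hr.2.le
  have hproj : h.proj a = h.proj t₁ := by
    refine h.proj_eq_of_le hat.le (le_antisymm hac hca) fun r h1 h2 => ?_
    rcases eq_or_lt_of_le h1 with rfl | h1
    · exact hca
    · exact habove r h1 h2
  refine ⟨a, le_antisymm hal ?_, hproj⟩
  rw [hl, ← hproj]
  exact h.firstVisit_le a

/-- Inside the interval this is the definition of `r(σ)`; the left endpoint is an attained infimum,
and the right one follows from left continuity of the projection. -/
theorem proj_eq_of_mem {σ : h.Tree} {t : Icc (0 : ℝ) h.lifetime}
    (ht : (t : ℝ) ∈ Icc (h.firstVisit σ) (h.firstExit σ)) : h.proj t = σ := by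
  obtain ⟨l, hl, hlσ⟩ := h.exists_firstVisit σ
  have before : ∀ s : Icc (0 : ℝ) h.lifetime, h.firstVisit σ < s → (s : ℝ) < h.firstExit σ →
      h.proj s = σ := by
    intro s h1 h2
    by_contra hne
    exact h2.not_ge (csInf_le (h.bddBelow_exits σ) (.inr ⟨s, rfl, h1, hne⟩))
  rcases eq_or_lt_of_le ht.1 with h1 | h1
  · rw [← hl] at h1
    rwa [← Subtype.ext h1]
  rcases eq_or_lt_of_le ht.2 with h2 | h2
  · have hlt : l < t := show (l : ℝ) < t by rwa [hl]
    have : (𝓝[<] t).NeBot := nhdsLT_neBot_of_exists_lt ⟨l, hlt⟩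
    refine tendsto_nhds_unique ((h.tendsto_proj_left t).mono_left
      (nhdsWithin_mono _ Iio_subset_Iic_self)) (tendsto_const_nhds.congr' ?_)
    filter_upwards [Ioo_mem_nhdsLT hlt] with s hs
    refine (before s ?_ ?_).symm
    · rw [← hl]; exact hs.1
    · rw [← h2]; exact hs.2
  · exact before t h1 h2

theorem exists_mem_of_notMem_latterVisitTimes {t : ℝ} (ht : t ∈ Icc 0 h.lifetime)
    (hS : t ∉ h.latterVisitTimes) : ∃ σ, t ∈ Icc (h.firstVisit σ) (h.firstExit σ) := by
  by_contra hne
  exact hS ⟨ht, fun hF => hne (mem_iUnion.1 hF)⟩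

/-- Two height functions agreeing almost everywhere are equal. -/
theorem ext_of_null {h₁ h₂ : HeightFunction} {D : Set ℝ}
    (hl : h₁.lifetime = h₂.lifetime) (hD : volume (Icc 0 h₁.lifetime \ D) = 0)
    (heq : ∀ (t₁ : Icc (0 : ℝ) h₁.lifetime) (t₂ : Icc (0 : ℝ) h₂.lifetime), (t₁ : ℝ) = t₂ →
      (t₁ : ℝ) ∈ D → h₁.toFun t₁ = h₂.toFun t₂) : h₁ = h₂ := by
  obtain ⟨M, hM, f₁, _, hc₁, _, h0₁, _⟩ := h₁
  obtain ⟨M', hM', f₂, _, hc₂, _, h0₂, _⟩ := h₂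
  change M = M' at hl
  subst hl
  suffices f₁ = f₂ by subst this; rfl
  funext t
  -- Left continuity says nothing at `0`, where the value is prescribed. Elsewhere, a discrepancy
  -- persists on a left neighbourhood of positive length.
  rcases eq_or_lt_of_le t.2.1 with h0 | h0
  · have : t = ⟨0, le_rfl, hM⟩ := Subtype.ext h0.symm
    rw [this, h0₁, h0₂]
  by_contra hne
  have h1 : Tendsto (fun s => f₁ s - f₂ s) (𝓝[≤] t) (𝓝 (f₁ t - f₂ t)) :=
    (hc₁ t).sub (hc₂ t)
  have h2 := h1.eventually_ne (sub_ne_zero.2 hne)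
  rw [eventually_nhdsWithin_iff, Metric.eventually_nhds_iff] at h2
  obtain ⟨δ, hδ, H⟩ := h2
  have h3 : Ioo (max 0 (t - δ)) (t : ℝ) ⊆ Icc 0 M \ D := by
    intro s hs
    have hs0 := (le_max_left 0 ((t : ℝ) - δ)).trans hs.1.le
    have hsδ := (le_max_right 0 ((t : ℝ) - δ)).trans_lt hs.1
    have hsM : s ∈ Icc 0 M := ⟨hs0, hs.2.le.trans t.2.2⟩
    refine ⟨hsM, fun hsD => H (y := ⟨s, hsM⟩) ?_ hs.2.le ?_⟩
    · change |s - t| < δ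
      rw [abs_of_nonpos (by linarith [hs.2])]
      linarith
    · exact sub_eq_zero.2 (heq ⟨s, hsM⟩ ⟨s, hsM⟩ rfl hsD)
  have h4 := measure_mono_null h3 hD
  rw [Real.volume_Ioo, ENNReal.ofReal_eq_zero] at h4
  have : max 0 ((t : ℝ) - δ) < t := max_lt h0 (by linarith)
  linarith

end HeightFunction

/-! ### Uniqueness: first visit intervals are determined by the measure. -/

section TransportMeasure

variable {T : Type*} [MetricSpace T] [MeasurableSpace T] [BorelSpace T]
  {μ : Measure T} {h : HeightFunction} {e : T ≃ᵢ h.Tree}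

/-- By (Min), almost every time lies in a first visit interval, whose point it projects to; hence
`B` and the set of times spent in `e(A)` differ by a null set. -/
theorem measure_eq_volume (hm : h.IsMinimal) (hμ : h.treeMeasure = μ.map e)
    {A : Set T} (hA : MeasurableSet A) {B : Set ℝ} (hB : B ⊆ Icc 0 h.lifetime)
    (hAB : ∀ a, ∀ t ∈ Icc (h.firstVisit (e a)) (h.firstExit (e a)), a ∈ A ↔ t ∈ B) :
    μ A = volume B := by
  have hA' : MeasurableSet (e.symm ⁻¹' A) := e.symm.continuous.measurable hA
  have h1 : μ A = h.treeMeasure (e.symm ⁻¹' A) := by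
    rw [hμ, Measure.map_apply e.continuous.measurable hA']
    congr 1
    ext x; simp
  rw [h1, h.treeMeasure_apply hA', ← measure_sdiff_null (s := B) hm, ← measure_sdiff_null hm]
  congr 1
  ext t
  constructor
  · rintro ⟨⟨t, ht, rfl⟩, hS⟩
    obtain ⟨σ, hσ⟩ := h.exists_mem_of_notMem_latterVisitTimes t.2 hS
    obtain ⟨a, rfl⟩ := e.surjective σ
    refine ⟨(hAB a t hσ).1 ?_, hS⟩
    rw [mem_preimage, h.proj_eq_of_mem hσ] at ht
    simpa using ht
  · rintro ⟨htB, hS⟩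
    obtain ⟨σ, hσ⟩ := h.exists_mem_of_notMem_latterVisitTimes (hB htB) hS
    obtain ⟨a, rfl⟩ := e.surjective σ
    refine ⟨⟨⟨t, hB htB⟩, ?_, rfl⟩, hS⟩
    rw [mem_preimage, h.proj_eq_of_mem hσ]
    simpa using (hAB a t hσ).2 htB

theorem lifetime_eq (hμ : h.treeMeasure = μ.map e) : h.lifetime = μ.real univ := by
  have h1 := h.treeMeasure_apply MeasurableSet.univ
  rw [hμ, Measure.map_apply e.continuous.measurable MeasurableSet.univ, preimage_univ,
    preimage_univ, image_univ, Subtype.range_coe, Real.volume_Icc, sub_zero] at h1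
  rw [measureReal_def, h1, ENNReal.toReal_ofReal h.lifetime_nonneg]

end TransportMeasure

section TransportOrder

variable {T : Type*} [MetricSpace T] [LinearOrder T] {h : HeightFunction} {e : T ≃ᵢ h.Tree}

theorem firstVisit_lt_firstVisit (hle : ∀ a b : T, a ≤ b → e a ≤ e b) {a b : T} (hab : a < b) :
    h.firstVisit (e a) < h.firstVisit (e b) := by
  refine lt_of_le_of_ne (hle a b hab.le) fun heq => hab.ne (e.injective ?_)
  obtain ⟨s, hs, hsa⟩ := h.exists_firstVisit (e a)
  obtain ⟨t, ht, htb⟩ := h.exists_firstVisit (e b)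
  rw [← hsa, ← htb, show s = t from Subtype.ext (by rw [hs, ht, heq])]

/-- Otherwise the first visit of `e b` would fall in the first visit interval of `e a`. -/
theorem firstExit_lt_firstVisit (hle : ∀ a b : T, a ≤ b → e a ≤ e b) {a b : T} (hab : a < b) :
    h.firstExit (e a) < h.firstVisit (e b) := by
  by_contra! hge
  obtain ⟨t, ht, htb⟩ := h.exists_firstVisit (e b)
  refine hab.ne (e.injective ?_)
  rw [← htb, h.proj_eq_of_mem]
  rw [ht]
  exact ⟨(firstVisit_lt_firstVisit hle hab).le, hge⟩

end TransportOrder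

section Uniqueness

variable {T : Type*} [MetricSpace T] [LinearOrder T] [MeasurableSpace T] [BorelSpace T]
  {ρ : T} {μ : Measure T} {h : HeightFunction} {e : T ≃ᵢ h.Tree}
  (hO : IsOrderedTree ρ)
include hO

/-- Up to a null set, the times before `ℓ(e a)` are those spent at images of points below `a`. -/
theorem firstVisit_eq_enter (hm : h.IsMinimal) (hle : ∀ a b : T, a ≤ b → e a ≤ e b)
    (hμ : h.treeMeasure = μ.map e) (a : T) : h.firstVisit (e a) = enter μ a := by
  have h1 : μ (Iio a) = volume (Ico 0 (h.firstVisit (e a))) := by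
    refine measure_eq_volume hm hμ (hO.measurableSet_Iio a)
      (fun t ht => ⟨ht.1, ht.2.le.trans (h.firstVisit_le_lifetime _)⟩) fun b t ht => ?_
    constructor
    · intro hba
      exact ⟨(h.firstVisit_nonneg _).trans ht.1,
        ht.2.trans_lt (firstExit_lt_firstVisit hle hba)⟩
    · intro htB
      by_contra hba
      exact (hle a b (not_lt.1 hba)).not_gt (ht.1.trans_lt htB.2)
  rw [enter, measureReal_def, h1, Real.volume_Ico, sub_zero,
    ENNReal.toReal_ofReal (h.firstVisit_nonneg _)]

theorem firstExit_eq_leave (hm : h.IsMinimal) (hle : ∀ a b : T, a ≤ b → e a ≤ e b)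
    (hμ : h.treeMeasure = μ.map e) (a : T) : h.firstExit (e a) = leave μ a := by
  have h1 : μ (Iic a) = volume (Icc 0 (h.firstExit (e a))) := by
    refine measure_eq_volume hm hμ (hO.measurableSet_Iic a)
      (fun t ht => ⟨ht.1, ht.2.trans (h.firstExit_le_lifetime _)⟩) fun b t ht => ?_
    constructor
    · intro hba
      refine ⟨(h.firstVisit_nonneg _).trans ht.1, ht.2.trans ?_⟩
      rcases eq_or_lt_of_le (show b ≤ a from hba) with rfl | hba
      · exact le_rfl
      · exact (firstExit_lt_firstVisit hle hba).le.trans (h.firstVisit_le_firstExit _)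
    · intro htB
      by_contra hba
      have h2 := firstExit_lt_firstVisit hle (not_le.1 (show ¬b ≤ a from hba))
      linarith [ht.1, htB.2]
  rw [leave, measureReal_def, h1, Real.volume_Icc, sub_zero,
    ENNReal.toReal_ofReal ((h.firstVisit_nonneg _).trans (h.firstVisit_le_firstExit _))]

theorem toFun_eq_of_mem (hm : h.IsMinimal) (hρ : e ρ = h.root)
    (hle : ∀ a b : T, a ≤ b → e a ≤ e b) (hμ : h.treeMeasure = μ.map e) {a : T}
    {t : Icc (0 : ℝ) h.lifetime} (ht : (t : ℝ) ∈ Icc (enter μ a) (leave μ a)) :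
    h.toFun t = dist ρ a := by
  rw [← firstVisit_eq_enter hO hm hle hμ, ← firstExit_eq_leave hO hm hle hμ] at ht
  rw [← h.dist_root_proj, h.proj_eq_of_mem ht, ← hρ, e.dist_eq]

theorem volume_Icc_sdiff_iUnion (hm : h.IsMinimal) (hle : ∀ a b : T, a ≤ b → e a ≤ e b)
    (hμ : h.treeMeasure = μ.map e) :
    volume (Icc 0 h.lifetime \ ⋃ a, Icc (enter μ a) (leave μ a)) = 0 := by
  refine measure_mono_null ?_ hm
  rintro t ⟨ht, h1⟩
  refine ⟨ht, fun h2 => h1 ?_⟩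
  obtain ⟨σ, hσ⟩ := mem_iUnion.1 h2
  obtain ⟨a, rfl⟩ := e.surjective σ
  refine mem_iUnion.2 ⟨a, ?_⟩
  rwa [← firstVisit_eq_enter hO hm hle hμ, ← firstExit_eq_leave hO hm hle hμ]

theorem eq_of_equivalent {h₁ h₂ : HeightFunction} (hm₁ : h₁.IsMinimal) (hm₂ : h₂.IsMinimal)
    (he₁ : Equivalent ρ μ h₁.root h₁.treeMeasure) (he₂ : Equivalent ρ μ h₂.root h₂.treeMeasure) :
    h₁ = h₂ := by
  obtain ⟨e₁, hρ₁, hle₁, hμ₁⟩ := he₁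
  obtain ⟨e₂, hρ₂, hle₂, hμ₂⟩ := he₂
  refine HeightFunction.ext_of_null ((lifetime_eq hμ₁).trans (lifetime_eq hμ₂).symm)
    (volume_Icc_sdiff_iUnion hO hm₁ hle₁ hμ₁) fun t₁ t₂ ht hD => ?_
  obtain ⟨a, ha⟩ := mem_iUnion.1 hD
  rw [toFun_eq_of_mem hO hm₁ hρ₁ hle₁ hμ₁ ha, toFun_eq_of_mem hO hm₂ hρ₂ hle₂ hμ₂ (ht ▸ ha)]

end Uniqueness

end RealTree

theorem theorem1 {T : Type*} [MetricSpace T] [CompactSpace T] (hT : RealTree.IsRealTree T)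
    (ρ : T) [LinearOrder T] [MeasurableSpace T] [BorelSpace T]
    (μ : Measure T) [IsFiniteMeasure μ]
    (hOr1 : RealTree.Or1 ρ) (hOr2 : RealTree.Or2 ρ) (hMes : RealTree.Mes μ) :
    ∃! h : RealTree.HeightFunction,
      h.IsMinimal ∧ RealTree.Equivalent ρ μ h.root h.treeMeasure := by
  have hO := hT.isOrderedTree hOr1 hOr2
  exact ⟨RealTree.heightOf hO hMes,
    ⟨RealTree.isMinimal_heightOf hO hMes, RealTree.equivalent_heightOf hO hMes⟩,
    fun h ⟨hm, he⟩ => RealTree.eq_of_equivalent hO hm (RealTree.isMinimal_heightOf hO hMes) he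
      (RealTree.equivalent_heightOf hO hMes)⟩
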